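/- Let $L>1$, $\alpha$ and $\sigma$ be real numbers. A real process $\{X_n\}_{n\in\mathbb Z}$ with finite variance and zero mean is called stationary if $\mathbb E[X_nX_{n-r}]$ does not depend on $n$ (wide-sense stationarity); it has power spectral density (PSD) $S_X$ if $S_X\ge 0$ is an integrable function on $[-\pi,\pi]$ with $\mathbb E[X_nX_{n-r}]=\frac1{2\pi}\int_{-\pi}^{\pi}S_X(e^{j\omega})e^{j\omega r}\,d\omega$ for all $n,r\in\mathbb Z$. Design of the filters. Let $\tilde V_n=\alpha\tilde X_n+\tilde Z_n$, where $\{\tilde X_n\}$ is a zero-mean stationary process whose PSD equals $L\sigma^2$ on $[-\pi/L,\pi/L)$ and $0$ elsewhere, and $\{\tilde Z_n\}$ is i.i.d. uniform on $[-1,0)$ and independent of $\{\tilde X_n\}$. For every $p\ge 0$ let $h^{(p)}=(h^{(p)}_1,\dots,h^{(p)}_p)\in\mathbb R^p$ be the optimal linear MMSE $p$-tap prediction filter for $\{\tilde V_n\}$, that is, a minimizer of $$\mathbb E\Big(\tilde V_n-\Big[\sum_{i=1}^p h_i\big(\tilde V_{n-i}+\tfrac12\big)-\tfrac12\Big]\Big)^2$$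 over $h\in\mathbb R^p$ (for every $n$). Use on another process. Let $\{X_n\}_{n\in\mathbb Z}$ be any zero-mean stationary process with $\mathbb E(X_n^2)\le\sigma^2$ that has a PSD vanishing on $[-\pi,\pi]$ outside $[-\pi/L,\pi/L]$, let $\{Z_n\}$ be i.i.d. uniform on $[-1,0)$ and independent of $\{X_n\}$, and let $V_n=\alpha X_n+Z_n$. Put $$\hat V_n^p=\sum_{i=1}^p h^{(p)}_i\big(V_{n-i}+\tfrac12\big)-\tfrac12,\qquad \sigma_p^2=\mathbb E\big(V_n-\hat V_n^p\big)^2 .$$ Then $\lim_{p\to\infty}12\sigma_p^2$ exists, does not depend on $n$, and $$\lim_{p\to\infty}12\,\sigma_p^2\le\left(1+12\alpha^2L\sigma^2\right)^{1/L}.$$ -/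

import Mathlib

open MeasureTheory ProbabilityTheory Filter Topology

namespace ModuloADC

noncomputable section

/-- A zero-mean, square-integrable, (wide-sense) stationary real process indexed by `ℤ`. Every
strictly stationary zero-mean process with finite variance is of this kind. -/
structure IsZeroMeanStationary {Ω : Type*} [MeasurableSpace Ω] (P : Measure Ω)
    (X : ℤ → Ω → ℝ) : Prop where
  memLp : ∀ n, MemLp (X n) 2 P
  mean_zero : ∀ n, ∫ ω, X n ω ∂P = 0
  autocov_eq : ∀ m n r : ℤ, ∫ ω, X m ω * X (m - r) ω ∂P = ∫ ω, X n ω * X (n - r) ω ∂P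

/-- `S`, as a function of the frequency in `[-π, π]`, is a power spectral density of the zero-mean
stationary process `X`: it is nonnegative and integrable, and
`E[X_n X_{n-r}] = (1/2π) ∫_{-π}^{π} S(w) e^{i r w} dw` for all `n` and `r`. -/
structure IsPSD {Ω : Type*} [MeasurableSpace Ω] (P : Measure Ω) (X : ℤ → Ω → ℝ)
    (S : ℝ → ℝ) : Prop where
  nonneg : ∀ w ∈ Set.Icc (-Real.pi) Real.pi, 0 ≤ S w
  integrable : IntegrableOn S (Set.Icc (-Real.pi) Real.pi)
  autocov_eq : ∀ n r : ℤ, ((∫ ω, X n ω * X (n - r) ω ∂P : ℝ) : ℂ) =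
    1 / (2 * (Real.pi : ℂ)) *
      ∫ w in (-Real.pi)..Real.pi, (S w : ℂ) * Complex.exp (Complex.I * r * w)

/-- The flat band-limited density: `L σ²` on `[-π/L, π/L)` and `0` elsewhere. -/
def flatPSD (L σ : ℝ) (w : ℝ) : ℝ :=
  (Set.Ico (-(Real.pi / L)) (Real.pi / L)).indicator (fun _ => L * σ ^ 2) w

/-- `Z` is an i.i.d. sequence, uniform on `[-1, 0)`, and independent of the process `X`. -/
structure IsQuantizationNoise {Ω : Type*} [MeasurableSpace Ω] (P : Measure Ω)
    (X Z : ℤ → Ω → ℝ) : Prop where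
  uniform : ∀ n, pdf.IsUniform (Z n) (Set.Ico (-1) 0) P volume
  iid : iIndepFun Z P
  indep : IndepFun (fun ω n => X n ω) (fun ω n => Z n ω) P

/-- The unfolded quantized process `V_n = α X_n + Z_n`. -/
def quantized {Ω : Type*} (α : ℝ) (X Z : ℤ → Ω → ℝ) (n : ℤ) (ω : Ω) : ℝ :=
  α * X n ω + Z n ω

/-- The `p`-tap prediction `V̂_n = ∑_{i=1}^p h_i (V_{n-i} + 1/2) - 1/2`; the tap `h_{i+1}` is the
entry of `h` at `i : Fin p`. -/
def prediction {Ω : Type*} (V : ℤ → Ω → ℝ) {p : ℕ} (h : Fin p → ℝ) (n : ℤ) (ω : Ω) : ℝ :=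
  (∑ i : Fin p, h i * (V (n - ((i : ℕ) + 1 : ℤ)) ω + 1 / 2)) - 1 / 2

/-- The mean square prediction error `E (V_n - V̂_n)²` of the filter `h` on the process `V`. -/
def predictionMSE {Ω : Type*} [MeasurableSpace Ω] (P : Measure Ω) (V : ℤ → Ω → ℝ) {p : ℕ}
    (h : Fin p → ℝ) (n : ℤ) : ℝ :=
  ∫ ω, (V n ω - prediction V h n ω) ^ 2 ∂P

/-- `h` is an optimal (MMSE) `p`-tap prediction filter for the process `V`. -/
def IsOptimalFilter {Ω : Type*} [MeasurableSpace Ω] (P : Measure Ω) (V : ℤ → Ω → ℝ) {p : ℕ}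
    (h : Fin p → ℝ) : Prop :=
  ∀ (g : Fin p → ℝ) (n : ℤ), predictionMSE P V h n ≤ predictionMSE P V g n

end

end ModuloADC

/-! After multiplication by 12 the noise has density 1, and the design process has density `w =
jumpWeight c b` on the upper half circle, with `c = 12α²Lσ²` and `b = π/L`. The error polynomial
`A_p = 1 - ∑ h_i z^i` of the optimal filter is the Szegő predictor of `w`. On the actual process, 12
times the mean square error is the mean of `w |A_p|² g`, where `g` is the ratio of the actual
density to the design density. The variance and support constraints force `g` to have mean at most
1.

It therefore suffices that `w |A_p|²` converge weakly to the constant `e = lim form w A_p A_p` and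
that `e ≤ (1 + c)^(1/L)`. Against trigonometric polynomials the convergence is soft: it follows from
orthogonality and the convergence of the prediction errors (`tendsto_form_mul_predictor`). But `g`
is only integrable, so a uniform bound on `w |A_p|²` is needed to pass to `L¹`
(`tendsto_integral_predictor_mul`).

That bound is the heart of the matter (`exists_norm_sq_circleEval_le`). The Levinson recursion makes
`|A_{n+1}| ≤ (1 + |a_n|) |A_n|` on the circle, with `a_n` the leading coefficient of `A_{n+1}`.
Integration by parts against the single jump gives `(n+1) |a_n| ≤ C |A_n(e^{ib})|²`
(`IsPredictor.reflection_coeff_le`), while a reproducing kernel estimate bounds the averages of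
`|A_k|²` at every point (`sum_norm_sq_le`). Hence the sum of `|a_n|` over a dyadic block is bounded,
and so is `|A_n|`.

The bound on `e` is the upper half of Szegő's theorem, proved by testing minimality on truncated
exponentials (`iInf_predictor_jumpWeight_le`). -/

namespace ModuloADC

open Polynomial ComplexConjugate

noncomputable section

/-! ### Real polynomials on the unit circle and weighted inner products -/

section Form

/-- The value of a real polynomial at the point `e^{iθ}` of the unit circle. -/
def circleEval (p : ℝ[X]) (θ : ℝ) : ℂ := aeval (Complex.exp (θ * Complex.I)) p

@[simp] lemma circleEval_add (p q : ℝ[X]) (θ : ℝ) :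
    circleEval (p + q) θ = circleEval p θ + circleEval q θ := by simp [circleEval]

@[simp] lemma circleEval_sub (p q : ℝ[X]) (θ : ℝ) :
    circleEval (p - q) θ = circleEval p θ - circleEval q θ := by simp [circleEval]

@[simp] lemma circleEval_mul (p q : ℝ[X]) (θ : ℝ) :
    circleEval (p * q) θ = circleEval p θ * circleEval q θ := by simp [circleEval]

@[simp] lemma circleEval_smul (c : ℝ) (p : ℝ[X]) (θ : ℝ) :
    circleEval (c • p) θ = c * circleEval p θ := by simp [circleEval]

@[simp] lemma circleEval_C (c : ℝ) (θ : ℝ) : circleEval (C c) θ = c := by simp [circleEval]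

@[simp] lemma circleEval_one (θ : ℝ) : circleEval 1 θ = 1 := by simp [circleEval]

@[simp] lemma circleEval_X (θ : ℝ) : circleEval X θ = Complex.exp (θ * Complex.I) := by
  simp [circleEval]

@[simp] lemma circleEval_X_pow (k : ℕ) (θ : ℝ) :
    circleEval (X ^ k) θ = Complex.exp (θ * Complex.I) ^ k := by
  simp [circleEval]

lemma circleEval_eq_sum (p : ℝ[X]) {n : ℕ} (hn : p.natDegree < n) (θ : ℝ) :
    circleEval p θ = ∑ i ∈ Finset.range n, (p.coeff i : ℂ) * Complex.exp (θ * Complex.I) ^ i := by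
  rw [circleEval, aeval_eq_sum_range' hn]
  simp

lemma continuous_circleEval (p : ℝ[X]) : Continuous (circleEval p) := by
  unfold circleEval
  fun_prop

lemma norm_circleEval_X (θ : ℝ) : ‖Complex.exp (θ * Complex.I)‖ = 1 :=
  Complex.norm_exp_ofReal_mul_I θ

lemma exp_mul_conj_exp (θ : ℝ) :
    Complex.exp (θ * Complex.I) * conj (Complex.exp (θ * Complex.I)) = 1 := by
  rw [Complex.mul_conj, Complex.normSq_eq_norm_sq, norm_circleEval_X]
  simp

/-- On the circle `z⁻¹ = conj z`, and the coefficients are real, so reversing them amounts to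
conjugating and rotating by `z^n`. -/
lemma circleEval_reflect {p : ℝ[X]} {n : ℕ} (hp : p.natDegree ≤ n) (θ : ℝ) :
    circleEval (reflect n p) θ = Complex.exp (θ * Complex.I) ^ n * conj (circleEval p θ) := by
  have hr : (reflect n p).natDegree < n + 1 :=
    Nat.lt_succ_of_le ((natDegree_reflect_le).trans (by simp [hp]))
  rw [circleEval_eq_sum _ hr, circleEval_eq_sum p (Nat.lt_succ_of_le hp), map_sum, Finset.mul_sum,
    ← Finset.sum_range_reflect]
  refine Finset.sum_congr rfl fun i hi => ?_
  have hi' : i ≤ n := Nat.lt_succ_iff.mp (Finset.mem_range.mp hi)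
  have h1 : n + 1 - 1 - i = n - i := by omega
  rw [h1, coeff_reflect, revAt_le (Nat.sub_le n i), Nat.sub_sub_self hi', map_mul, map_pow,
    Complex.conj_ofReal]
  have h2 : Complex.exp (θ * Complex.I) ^ n
      = Complex.exp (θ * Complex.I) ^ (n - i) * Complex.exp (θ * Complex.I) ^ i := by
    rw [← pow_add, Nat.sub_add_cancel hi']
  have h3 := congrArg (· ^ i) (exp_mul_conj_exp θ)
  simp only [mul_pow, one_pow] at h3
  rw [h2]
  linear_combination (-(p.coeff i : ℂ) * Complex.exp (θ * Complex.I) ^ (n - i)) * h3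

/-- The sesquilinear pairing of two polynomials with respect to the even density `w` on the unit
circle, as an integral over the upper half circle. -/
def form (w : ℝ → ℝ) (p q : ℝ[X]) : ℝ :=
  1 / Real.pi * ∫ θ in (0)..Real.pi, w θ * (circleEval p θ * conj (circleEval q θ)).re

lemma continuous_re_mul_conj (p q : ℝ[X]) :
    Continuous fun θ => (circleEval p θ * conj (circleEval q θ)).re := by
  have := continuous_circleEval p
  have := continuous_circleEval q
  fun_prop

variable {w : ℝ → ℝ}

lemma form_integrable (hw : IntervalIntegrable w volume 0 Real.pi) (p q : ℝ[X]) :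
    IntervalIntegrable (fun θ => w θ * (circleEval p θ * conj (circleEval q θ)).re)
      volume 0 Real.pi :=
  hw.mul_continuousOn (continuous_re_mul_conj p q).continuousOn

lemma form_comm (w : ℝ → ℝ) (p q : ℝ[X]) : form w p q = form w q p := by
  unfold form
  simp only [Complex.mul_re, Complex.conj_re, Complex.conj_im, mul_neg, mul_comm]

lemma form_add_left (hw : IntervalIntegrable w volume 0 Real.pi) (p p' q : ℝ[X]) :
    form w (p + p') q = form w p q + form w p' q := by
  unfold form
  rw [← mul_add, ← intervalIntegral.integral_add (form_integrable hw _ _) (form_integrable hw _ _)]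
  congr 2
  ext θ
  simp [Complex.mul_re]
  ring

lemma form_smul_left (w : ℝ → ℝ) (c : ℝ) (p q : ℝ[X]) :
    form w (c • p) q = c * form w p q := by
  unfold form
  rw [mul_left_comm, ← intervalIntegral.integral_const_mul c]
  refine congrArg (fun x : ℝ => 1 / Real.pi * x) (intervalIntegral.integral_congr fun θ _ => ?_)
  simp [Complex.mul_re]
  ring

/-- `form w` as a bilinear form, for an integrable density `w`. -/
def bilin (hw : IntervalIntegrable w volume 0 Real.pi) : LinearMap.BilinForm ℝ ℝ[X] :=
  LinearMap.mk₂ ℝ (form w) (form_add_left hw) (form_smul_left w)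
    (fun p q q' => by rw [form_comm, form_add_left hw, form_comm w q, form_comm w q'])
    (fun c p q => by rw [form_comm, form_smul_left, form_comm w q]; rfl)

lemma bilin_apply (hw : IntervalIntegrable w volume 0 Real.pi) (p q : ℝ[X]) :
    bilin hw p q = form w p q := rfl

lemma form_add_right (hw : IntervalIntegrable w volume 0 Real.pi) (p q q' : ℝ[X]) :
    form w p (q + q') = form w p q + form w p q' := (bilin hw p).map_add q q'

lemma form_sub_right (hw : IntervalIntegrable w volume 0 Real.pi) (p q q' : ℝ[X]) :
    form w p (q - q') = form w p q - form w p q' := (bilin hw p).map_sub q q'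

lemma form_sub_left (hw : IntervalIntegrable w volume 0 Real.pi) (p p' q : ℝ[X]) :
    form w (p - p') q = form w p q - form w p' q := by
  rw [form_comm, form_sub_right hw, form_comm w q, form_comm w q]

lemma form_smul_right (w : ℝ → ℝ) (c : ℝ) (p q : ℝ[X]) :
    form w p (c • q) = c * form w p q := by rw [form_comm, form_smul_left, form_comm]

lemma form_eq_sum_right (hw : IntervalIntegrable w volume 0 Real.pi) (p : ℝ[X]) {q : ℝ[X]} {n : ℕ}
    (hq : q.natDegree < n) :
    form w p q = ∑ i ∈ Finset.range n, q.coeff i * form w p (X ^ i) := by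
  conv_lhs => rw [q.as_sum_range' n hq]
  rw [← bilin_apply hw, map_sum]
  refine Finset.sum_congr rfl fun i _ => ?_
  rw [← smul_X_eq_monomial, bilin_apply, form_smul_right]

/-- Shift invariance, from `|z| = 1`: the Gram matrix of the monomials is Toeplitz, which is what
makes the Levinson recursion possible. -/
lemma form_X_mul (w : ℝ → ℝ) (p q : ℝ[X]) : form w (X * p) (X * q) = form w p q := by
  unfold form
  congr 2
  ext θ
  have h := exp_mul_conj_exp θ
  rw [circleEval_mul, circleEval_mul, circleEval_X, map_mul]
  congr 2
  linear_combination (circleEval p θ * conj (circleEval q θ)) * h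

lemma form_reflect (w : ℝ → ℝ) {p q : ℝ[X]} {n : ℕ} (hp : p.natDegree ≤ n)
    (hq : q.natDegree ≤ n) : form w (reflect n p) (reflect n q) = form w p q := by
  rw [form_comm w p q]
  unfold form
  congr 2
  ext θ
  have h := congrArg (· ^ n) (exp_mul_conj_exp θ)
  simp only [mul_pow, one_pow] at h
  rw [circleEval_reflect hp, circleEval_reflect hq, map_mul, map_pow, Complex.conj_conj]
  congr 2
  linear_combination (circleEval q θ * conj (circleEval p θ)) * h

lemma re_mul_conj_self (z : ℂ) : (z * conj z).re = ‖z‖ ^ 2 := by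
  rw [Complex.mul_conj, Complex.normSq_eq_norm_sq, Complex.ofReal_re]

lemma form_self (w : ℝ → ℝ) (p : ℝ[X]) :
    form w p p = 1 / Real.pi * ∫ θ in (0)..Real.pi, w θ * ‖circleEval p θ‖ ^ 2 := by
  simp only [form, re_mul_conj_self]

lemma form_self_mono {w' : ℝ → ℝ} (hw : IntervalIntegrable w volume 0 Real.pi)
    (hw' : IntervalIntegrable w' volume 0 Real.pi) (hle : ∀ θ, w θ ≤ w' θ) (p : ℝ[X]) :
    form w p p ≤ form w' p p := by
  unfold form
  refine mul_le_mul_of_nonneg_left ?_ (by positivity)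
  refine intervalIntegral.integral_mono Real.pi_pos.le (form_integrable hw _ _)
    (form_integrable hw' _ _) fun θ => ?_
  simp only [re_mul_conj_self]
  exact mul_le_mul_of_nonneg_right (hle θ) (by positivity)

lemma form_monomials (w : ℝ → ℝ) (i j : ℕ) :
    form w (X ^ i) (X ^ j) = 1 / Real.pi * ∫ θ in (0)..Real.pi,
      w θ * Real.cos (((i : ℤ) - j : ℤ) * θ) := by
  unfold form
  congr 2
  ext θ
  congr 1
  rw [circleEval_X_pow, circleEval_X_pow, ← Complex.exp_nat_mul, ← Complex.exp_nat_mul,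
    ← Complex.exp_conj, ← Complex.exp_add]
  have : (i : ℂ) * (θ * Complex.I) + conj ((j : ℂ) * (θ * Complex.I))
      = ((((i : ℤ) - j : ℤ) * θ : ℝ) : ℂ) * Complex.I := by
    simp
    ring
  rw [this, Complex.exp_ofReal_mul_I_re]

lemma integral_cos_int_mul (k : ℤ) :
    1 / Real.pi * ∫ θ in (0)..Real.pi, Real.cos (k * θ) = if k = 0 then 1 else 0 := by
  split_ifs with hk
  · subst hk
    simp [Real.pi_ne_zero]
  · have hk' : (k : ℝ) ≠ 0 := by exact_mod_cast hk
    rw [intervalIntegral.integral_comp_mul_left (fun x => Real.cos x) hk']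
    simp [Real.sin_int_mul_pi]

lemma one_intervalIntegrable : IntervalIntegrable (fun _ : ℝ => (1 : ℝ)) volume 0 Real.pi :=
  intervalIntegrable_const

lemma form_one_monomials (i j : ℕ) :
    form (fun _ => 1) (X ^ i) (X ^ j) = if i = j then 1 else 0 := by
  rw [form_monomials]
  simp only [one_mul]
  rw [integral_cos_int_mul]
  congr 1
  simp [sub_eq_zero]

lemma form_one_self {p : ℝ[X]} {n : ℕ} (hp : p.natDegree < n) :
    form (fun _ => 1) p p = ∑ i ∈ Finset.range n, p.coeff i ^ 2 := by
  rw [form_eq_sum_right one_intervalIntegrable p hp]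
  refine Finset.sum_congr rfl fun i hi => ?_
  rw [form_comm, form_eq_sum_right one_intervalIntegrable _ hp]
  simp only [form_one_monomials, mul_ite, mul_one, mul_zero]
  rw [Finset.sum_ite_eq, if_pos hi, sq]

/-- Cauchy–Schwarz on the coefficients, combined with Parseval for the density 1. -/
lemma norm_circleEval_sq_le {p : ℝ[X]} {n : ℕ} (hp : p.natDegree < n) (θ : ℝ) :
    ‖circleEval p θ‖ ^ 2 ≤ n * form (fun _ => 1) p p := by
  have h1 : ‖circleEval p θ‖ ≤ ∑ i ∈ Finset.range n, |p.coeff i| := by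
    rw [circleEval_eq_sum p hp]
    refine (norm_sum_le _ _).trans (Finset.sum_le_sum fun i _ => ?_)
    rw [norm_mul, norm_pow, norm_circleEval_X]
    simp
  rw [form_one_self hp]
  calc ‖circleEval p θ‖ ^ 2 ≤ (∑ i ∈ Finset.range n, |p.coeff i|) ^ 2 := by gcongr
    _ ≤ (Finset.range n).card * ∑ i ∈ Finset.range n, |p.coeff i| ^ 2 :=
        sq_sum_le_card_mul_sum_sq
    _ = _ := by simp

end Form

/-! ### Predictors, the Levinson recursion and kernel bounds -/

section Predictor

variable {w : ℝ → ℝ}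

/-- `A` is the `n`-step prediction polynomial of the density `w`: it has degree at most `n` and
constant term `1`, and it is orthogonal to `X, …, X ^ n`. -/
structure IsPredictor (w : ℝ → ℝ) (n : ℕ) (A : ℝ[X]) : Prop where
  natDegree_le : A.natDegree ≤ n
  coeff_zero : A.coeff 0 = 1
  orth : ∀ k, 1 ≤ k → k ≤ n → form w A (X ^ k) = 0

lemma eq_zero_of_form_self_nonpos (hw : IntervalIntegrable w volume 0 Real.pi)
    (h1 : ∀ θ, 1 ≤ w θ) {p : ℝ[X]} (hp : form w p p ≤ 0) : p = 0 := by
  have h := (form_self_mono one_intervalIntegrable hw h1 p).trans hp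
  rw [form_one_self (Nat.lt_succ_self _)] at h
  ext i
  by_cases hi : i ∈ Finset.range (p.natDegree + 1)
  · have h2 : p.coeff i ^ 2 ≤ 0 :=
      (Finset.single_le_sum (f := fun i => p.coeff i ^ 2) (fun _ _ => sq_nonneg _) hi).trans h
    simpa using le_antisymm h2 (sq_nonneg _)
  · rw [coeff_eq_zero_of_natDegree_lt (by simpa using hi), Polynomial.coeff_zero]

lemma coeff_zero_sq_le_form_self (hw : IntervalIntegrable w volume 0 Real.pi)
    (h1 : ∀ θ, 1 ≤ w θ) (p : ℝ[X]) : p.coeff 0 ^ 2 ≤ form w p p := by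
  refine le_trans ?_ (form_self_mono one_intervalIntegrable hw h1 p)
  rw [form_one_self (Nat.lt_succ_self _)]
  exact Finset.single_le_sum (f := fun i => p.coeff i ^ 2) (fun _ _ => sq_nonneg _) (by simp)

lemma form_self_nonneg (hw : IntervalIntegrable w volume 0 Real.pi)
    (h1 : ∀ θ, 1 ≤ w θ) (p : ℝ[X]) : 0 ≤ form w p p :=
  (sq_nonneg _).trans (coeff_zero_sq_le_form_self hw h1 p)

namespace IsPredictor

variable {n : ℕ} {A : ℝ[X]}

lemma form_eq_zero (hA : IsPredictor w n A) (hw : IntervalIntegrable w volume 0 Real.pi) {r : ℝ[X]}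
    (hr : r.natDegree ≤ n) (hr0 : r.coeff 0 = 0) : form w A r = 0 := by
  rw [form_eq_sum_right hw A (Nat.lt_succ_of_le hr)]
  refine Finset.sum_eq_zero fun k hk => ?_
  rcases Nat.eq_zero_or_pos k with rfl | hk'
  · rw [hr0, zero_mul]
  · rw [hA.orth k hk' (Nat.lt_succ_iff.mp (Finset.mem_range.mp hk)), mul_zero]

/-- Since `q - q(0) A` has degree at most `n` and no constant term, it is orthogonal to `A`. -/
lemma form_eq (hA : IsPredictor w n A) (hw : IntervalIntegrable w volume 0 Real.pi) {q : ℝ[X]}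
    (hq : q.natDegree ≤ n) : form w A q = q.coeff 0 * form w A A := by
  rw [← form_smul_right, ← sub_eq_zero, ← form_sub_right hw]
  refine hA.form_eq_zero hw ?_ ?_
  · exact (natDegree_sub_le _ _).trans
      (max_le hq ((natDegree_smul_le _ _).trans hA.natDegree_le))
  · simp [hA.coeff_zero]

lemma one_le (hA : IsPredictor w n A) (hw : IntervalIntegrable w volume 0 Real.pi)
    (h1 : ∀ θ, 1 ≤ w θ) : 1 ≤ form w A A := by
  have := coeff_zero_sq_le_form_self hw h1 A
  rwa [hA.coeff_zero, one_pow] at this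

lemma form_sub_self (hA : IsPredictor w n A) (hw : IntervalIntegrable w volume 0 Real.pi)
    {p : ℝ[X]} (hp : p.natDegree ≤ n) (hp0 : p.coeff 0 = 1) :
    form w (p - A) (p - A) = form w p p - form w A A := by
  have h1 : form w A p = form w A A := by rw [hA.form_eq hw hp, hp0, one_mul]
  rw [form_sub_left hw, form_sub_right hw, form_sub_right hw, form_comm w p A, h1]
  ring

lemma form_self_le (hA : IsPredictor w n A) (hw : IntervalIntegrable w volume 0 Real.pi)
    (h1 : ∀ θ, 1 ≤ w θ) {p : ℝ[X]} (hp : p.natDegree ≤ n) (hp0 : p.coeff 0 = 1) :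
    form w A A ≤ form w p p := by
  have := form_self_nonneg hw h1 (p - A)
  rw [hA.form_sub_self hw hp hp0] at this
  linarith

lemma natDegree_reflect_self_le (hA : IsPredictor w n A) : (reflect n A).natDegree ≤ n :=
  natDegree_reflect_le.trans (by simp [hA.natDegree_le])

/-- Reversal preserves the form and exchanges constant and top coefficients. Thus the reversed
predictors are the monic orthogonal polynomials of `w`. -/
lemma form_reflect_left (hA : IsPredictor w n A) (hw : IntervalIntegrable w volume 0 Real.pi)
    {q : ℝ[X]} (hq : q.natDegree ≤ n) :
    form w (reflect n A) q = q.coeff n * form w A A := by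
  have hr : (reflect n q).natDegree ≤ n := natDegree_reflect_le.trans (by simp [hq])
  have h := form_reflect w hA.natDegree_le hr
  rw [reflect_reflect] at h
  rw [h, hA.form_eq hw hr, coeff_reflect, revAt_le (Nat.zero_le n), Nat.sub_zero]

lemma form_X_mul_reflect_left (hA : IsPredictor w n A)
    (hw : IntervalIntegrable w volume 0 Real.pi)
    {q : ℝ[X]} (hq : q.natDegree ≤ n + 1) (hq0 : q.coeff 0 = 0) :
    form w (X * reflect n A) q = q.coeff (n + 1) * form w A A := by
  have hq' : q = X * q.divX := by
    conv_lhs => rw [← q.X_mul_divX_add, hq0, C_0, add_zero]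
  have hd : q.divX.natDegree ≤ n := by rw [natDegree_divX_eq_natDegree_tsub_one]; omega
  rw [hq', form_X_mul, hA.form_reflect_left hw hd, coeff_X_mul]

lemma natDegree_X_mul_reflect_le (hA : IsPredictor w n A) :
    (X * reflect n A).natDegree ≤ n + 1 := by
  refine natDegree_mul_le.trans ?_
  have := hA.natDegree_reflect_self_le
  have := natDegree_X_le (R := ℝ)
  omega

lemma norm_circleEval_reflect (hA : IsPredictor w n A) (θ : ℝ) :
    ‖circleEval (reflect n A) θ‖ = ‖circleEval A θ‖ := by
  rw [circleEval_reflect hA.natDegree_le, norm_mul, norm_pow, norm_circleEval_X, one_pow, one_mul,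
    Complex.norm_conj]

/-- The Levinson–Szegő recursion. -/
lemma levinson (hA : IsPredictor w n A) (hw : IntervalIntegrable w volume 0 Real.pi)
    (h1 : ∀ θ, 1 ≤ w θ) {A' : ℝ[X]} (hA' : IsPredictor w (n + 1) A') :
    A' = A + A'.coeff (n + 1) • (X * reflect n A) := by
  have hA1 : A.coeff (n + 1) = 0 :=
    coeff_eq_zero_of_natDegree_lt (Nat.lt_succ_of_le hA.natDegree_le)
  -- The reversal of `A` has top coefficient `A(0) = 1`, so `D` loses its top coefficient as well as
  -- its constant term. Each of the three summands of `D` is then orthogonal to `D`, and positivity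
  -- gives `D = 0`.
  set D := A' - (A + A'.coeff (n + 1) • (X * reflect n A)) with hD
  have hdeg' : D.natDegree ≤ n + 1 := by
    refine (natDegree_sub_le _ _).trans (max_le hA'.natDegree_le ?_)
    refine (natDegree_add_le _ _).trans (max_le (hA.natDegree_le.trans n.le_succ) ?_)
    exact (natDegree_smul_le _ _).trans hA.natDegree_X_mul_reflect_le
  have hcoeff : D.coeff (n + 1) = 0 := by
    simp [hD, hA1, coeff_reflect, revAt_le le_rfl, hA.coeff_zero]
  have hdeg : D.natDegree ≤ n := by
    rw [natDegree_le_iff_coeff_eq_zero]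
    intro k hk
    rcases (Nat.succ_le_of_lt hk).eq_or_lt with rfl | hk'
    · exact hcoeff
    · exact coeff_eq_zero_of_natDegree_lt (hdeg'.trans_lt hk')
  have hD0 : D.coeff 0 = 0 := by simp [hD, hA.coeff_zero, hA'.coeff_zero]
  have hself : form w D D = 0 := by
    conv_lhs => enter [2]; rw [hD]
    rw [form_sub_left hw, form_add_left hw, form_smul_left, hA.form_eq_zero hw hdeg hD0,
      hA'.form_eq_zero hw hdeg' hD0, hA.form_X_mul_reflect_left hw hdeg' hD0, hcoeff]
    ring
  exact sub_eq_zero.mp (eq_zero_of_form_self_nonpos hw h1 hself.le)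

/-- Pythagoras applied to the recursion yields `a² E = E - E'` for the prediction errors `E`, `E'`,
both of which are at least 1. -/
lemma abs_coeff_le_one (hA : IsPredictor w n A) (hw : IntervalIntegrable w volume 0 Real.pi)
    (h1 : ∀ θ, 1 ≤ w θ) {A' : ℝ[X]} (hA' : IsPredictor w (n + 1) A') :
    |A'.coeff (n + 1)| ≤ 1 := by
  have hl := hA.levinson hw h1 hA'
  set a := A'.coeff (n + 1)
  have hsub : A - A' = (-a) • (X * reflect n A) := by
    rw [neg_smul]; nth_rw 1 [hl]; abel_nf
  have h := hA'.form_sub_self hw (hA.natDegree_le.trans n.le_succ) hA.coeff_zero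
  rw [hsub, form_smul_left, form_smul_right, form_X_mul,
    form_reflect w hA.natDegree_le hA.natDegree_le] at h
  have hE := hA.one_le hw h1
  have hE' := hA'.one_le hw h1
  rw [abs_le_one_iff_mul_self_le_one]
  nlinarith

lemma norm_circleEval_succ_le (hA : IsPredictor w n A)
    (hw : IntervalIntegrable w volume 0 Real.pi)
    (h1 : ∀ θ, 1 ≤ w θ) {A' : ℝ[X]} (hA' : IsPredictor w (n + 1) A') (θ : ℝ) :
    ‖circleEval A' θ‖ ≤ (1 + |A'.coeff (n + 1)|) * ‖circleEval A θ‖ := by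
  have h := congrArg (circleEval · θ) (hA.levinson hw h1 hA')
  simp only [circleEval_add, circleEval_smul, circleEval_mul] at h
  rw [h]
  refine (norm_add_le _ _).trans (le_of_eq ?_)
  rw [norm_mul, norm_mul, hA.norm_circleEval_reflect, circleEval_X, norm_circleEval_X,
    Complex.norm_real, Real.norm_eq_abs]
  ring

end IsPredictor

/-- A Christoffel function estimate: as `w ≥ 1`, the norm of `ℓ` on polynomials of degree below `N`
is no larger for `w` than for the density 1. That norm is computed in the orthogonal basis of
reversed predictors. -/
lemma sum_sq_functional_le (hw : IntervalIntegrable w volume 0 Real.pi) (h1 : ∀ θ, 1 ≤ w θ)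
    {A : ℕ → ℝ[X]} (hA : ∀ n, IsPredictor w n (A n)) (ℓ : ℝ[X] →ₗ[ℝ] ℝ) (N : ℕ)
    (hℓ : ∀ p : ℝ[X], p.natDegree < N → ℓ p ^ 2 ≤ N * form (fun _ => 1) p p) :
    ∑ k ∈ Finset.range N, ℓ (reflect k (A k)) ^ 2 ≤ N * form w 1 1 := by
  set E : ℕ → ℝ := fun k => form w (A k) (A k)
  set Φ : ℕ → ℝ[X] := fun k => reflect k (A k)
  have hE : ∀ k, 1 ≤ E k := fun k => (hA k).one_le hw h1
  have hE1 : ∀ k, E k ≤ form w 1 1 := fun k => (hA k).form_self_le hw h1 (by simp) (by simp)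
  have hΦΦ : ∀ k, form w (Φ k) (Φ k) = E k := fun k =>
    form_reflect w (hA k).natDegree_le (hA k).natDegree_le
  have hlt : ∀ j k, j < k → form w (Φ k) (Φ j) = 0 := fun j k hjk => by
    have hdeg : (Φ j).natDegree < k := ((hA j).natDegree_reflect_self_le).trans_lt hjk
    rw [(hA k).form_reflect_left hw hdeg.le, coeff_eq_zero_of_natDegree_lt hdeg, zero_mul]
  have hne : ∀ j k, j ≠ k → form w (Φ j) (Φ k) = 0 := fun j k hjk => by
    rcases lt_or_gt_of_ne hjk with h | h
    · rw [form_comm, hlt j k h]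
    · exact hlt k j h
  rcases Nat.eq_zero_or_pos N with rfl | hN
  · simp
  -- `P` is the Riesz representer of `ℓ` for `form w`, so `ℓ P = form w P P = K`. The hypothesis on
  -- `ℓ` then reads `K² ≤ N K`.
  set P : ℝ[X] := ∑ k ∈ Finset.range N, (ℓ (Φ k) / E k) • Φ k with hP
  set K : ℝ := ∑ k ∈ Finset.range N, ℓ (Φ k) ^ 2 / E k with hK
  have hPdeg : P.natDegree < N := by
    refine lt_of_le_of_lt (natDegree_sum_le_of_forall_le (n := N - 1) _ _ fun k hk => ?_)
      (Nat.sub_lt hN one_pos)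
    refine (natDegree_smul_le _ _).trans ((hA k).natDegree_reflect_self_le.trans ?_)
    have := Finset.mem_range.mp hk
    omega
  have hℓP : ℓ P = K := by
    rw [hP, map_sum, hK]
    refine Finset.sum_congr rfl fun k _ => ?_
    rw [map_smul, smul_eq_mul]
    ring
  have hPP : form w P P = K := by
    rw [← bilin_apply hw, hP, LinearMap.map_sum₂, hK]
    refine Finset.sum_congr rfl fun k hk => ?_
    rw [map_sum, Finset.sum_eq_single k]
    · rw [bilin_apply, form_smul_left, form_smul_right, hΦΦ]
      have := hE k
      field_simp
    · intro j _ hj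
      rw [bilin_apply, form_smul_left, form_smul_right, hne k j hj.symm]
      ring
    · exact fun h => absurd hk h
  have hK0 : 0 ≤ K := Finset.sum_nonneg fun k _ =>
    div_nonneg (sq_nonneg _) (zero_le_one.trans (hE k))
  have hKN : K ≤ N := by
    have h := (hℓ P hPdeg).trans (mul_le_mul_of_nonneg_left
      (form_self_mono one_intervalIntegrable hw h1 P) (Nat.cast_nonneg N))
    rw [hℓP, hPP] at h
    by_contra! hlt'
    have : (0 : ℝ) < N := by exact_mod_cast hN
    nlinarith
  calc ∑ k ∈ Finset.range N, ℓ (Φ k) ^ 2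
      ≤ ∑ k ∈ Finset.range N, form w 1 1 * (ℓ (Φ k) ^ 2 / E k) := by
        refine Finset.sum_le_sum fun k _ => ?_
        have hk := hE k
        rw [mul_div_assoc', le_div_iff₀ (by linarith), mul_comm]
        exact mul_le_mul_of_nonneg_right (hE1 k) (sq_nonneg _)
    _ = form w 1 1 * K := by rw [← Finset.mul_sum]
    _ ≤ _ := by
        rw [mul_comm]
        exact mul_le_mul_of_nonneg_right hKN (zero_le_one.trans ((hE 0).trans (hE1 0)))

/-- Evaluation at a point is complex valued, so the functional bound is applied to its real and
imaginary parts; this is the factor 2. -/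
lemma sum_norm_sq_le (hw : IntervalIntegrable w volume 0 Real.pi) (h1 : ∀ θ, 1 ≤ w θ)
    {A : ℕ → ℝ[X]} (hA : ∀ n, IsPredictor w n (A n)) (N : ℕ) (θ : ℝ) :
    ∑ k ∈ Finset.range N, ‖circleEval (A k) θ‖ ^ 2 ≤ 2 * form w 1 1 * N := by
  let ev : ℝ[X] →ₗ[ℝ] ℂ :=
    (aeval (R := ℝ) (Complex.exp (θ * Complex.I))).toLinearMap
  have hev : ∀ p, ev p = circleEval p θ := fun p => rfl
  have hre := sum_sq_functional_le hw h1 hA (Complex.reLm ∘ₗ ev) N fun p hp => by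
    refine le_trans ?_ (norm_circleEval_sq_le hp θ)
    simp only [LinearMap.comp_apply, Complex.reLm_coe, hev]
    exact sq_le_sq.mpr ((Complex.abs_re_le_norm _).trans (le_abs_self _))
  have him := sum_sq_functional_le hw h1 hA (Complex.imLm ∘ₗ ev) N fun p hp => by
    refine le_trans ?_ (norm_circleEval_sq_le hp θ)
    simp only [LinearMap.comp_apply, Complex.imLm_coe, hev]
    exact sq_le_sq.mpr ((Complex.abs_im_le_norm _).trans (le_abs_self _))
  have := add_le_add hre him
  rw [← Finset.sum_add_distrib] at this
  refine le_trans (le_of_eq (Finset.sum_congr rfl fun k _ => ?_)) (this.trans (by linarith))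
  rw [← (hA k).norm_circleEval_reflect, ← Complex.normSq_eq_norm_sq, Complex.normSq_apply]
  simp only [LinearMap.comp_apply, Complex.reLm_coe, Complex.imLm_coe, hev]
  ring

/-- A sequence with bounded averages whose growth rate is controlled by another sequence with
bounded averages is bounded. -/
lemma le_of_average_le {x y b : ℕ → ℝ} {c d e : ℝ} (hc : 0 ≤ c)
    (hx : ∀ n, 0 ≤ x n) (hy : ∀ n, 0 ≤ y n) (he : 0 ≤ e)
    (hstep : ∀ n, x (n + 1) ≤ Real.exp (2 * b n) * x n)
    (hb : ∀ n, (n + 1) * b n ≤ e * y n)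
    (hxs : ∀ n, ∑ k ∈ Finset.range n, x k ≤ c * n)
    (hys : ∀ n, ∑ k ∈ Finset.range n, y k ≤ d * n) (n : ℕ) :
    x n ≤ 2 * c * Real.exp (4 * e * d) := by
  have hd : 0 ≤ d := by
    have := hys 1
    simp at this
    exact (hy 0).trans this
  rcases Nat.eq_zero_or_pos n with rfl | hn
  · have h := hxs 1
    simp at h
    have : 1 ≤ Real.exp (4 * e * d) := Real.one_le_exp (by positivity)
    nlinarith
  have hnR : (0 : ℝ) < n := by exact_mod_cast hn
  -- Pigeonhole: were `x` above `2c` on all of `[n/2, n)`, its sum would exceed `c n`.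
  obtain ⟨k, hk1, hk2, hkx⟩ : ∃ k, n / 2 ≤ k ∧ k < n ∧ x k ≤ 2 * c := by
    by_contra! hcon
    have h2 : ∑ k ∈ Finset.Ico (n / 2) n, 2 * c < ∑ k ∈ Finset.Ico (n / 2) n, x k := by
      refine Finset.sum_lt_sum_of_nonempty (Finset.nonempty_Ico.mpr (Nat.div_lt_self hn one_lt_two))
        fun k hk => ?_
      rw [Finset.mem_Ico] at hk
      exact hcon k hk.1 hk.2
    have h3 : ∑ k ∈ Finset.Ico (n / 2) n, x k ≤ ∑ k ∈ Finset.range n, x k := by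
      rw [Finset.range_eq_Ico]
      exact Finset.sum_le_sum_of_subset_of_nonneg (Finset.Ico_subset_Ico_left (Nat.zero_le _))
        fun k _ _ => hx k
    have h4 := hxs n
    rw [Finset.sum_const, Nat.card_Ico, nsmul_eq_mul] at h2
    have h5 : (n : ℝ) ≤ 2 * ((n - n / 2 : ℕ) : ℝ) := by exact_mod_cast (by omega)
    nlinarith
  have hiter : ∀ m, k ≤ m → x m ≤ Real.exp (2 * ∑ j ∈ Finset.Ico k m, b j) * x k := by
    intro m hm
    induction m, hm using Nat.le_induction with
    | base => simp
    | succ m hm ih =>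
      rw [Finset.sum_Ico_succ_top hm, mul_add, Real.exp_add]
      calc x (m + 1) ≤ Real.exp (2 * b m) * x m := hstep m
        _ ≤ Real.exp (2 * b m) * (Real.exp (2 * ∑ j ∈ Finset.Ico k m, b j) * x k) := by gcongr
        _ = _ := by ring
  -- For `j ≥ n/2` the weight `1/(j+1)` is at most `2/n`, so this sum is controlled by an average of
  -- `y`.
  have hsum : ∑ j ∈ Finset.Ico k n, b j ≤ 2 * e * d := by
    calc ∑ j ∈ Finset.Ico k n, b j ≤ ∑ j ∈ Finset.Ico k n, 2 * e / n * y j := by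
          refine Finset.sum_le_sum fun j hj => ?_
          rw [Finset.mem_Ico] at hj
          have h1 : (n : ℝ) ≤ 2 * (j + 1) := by exact_mod_cast (by omega)
          have h2 := hb j
          have h3 : 0 ≤ e * y j := mul_nonneg he (hy j)
          rw [div_mul_eq_mul_div, le_div_iff₀ hnR]
          rcases le_or_gt (b j) 0 with h0 | h0
          · nlinarith
          · nlinarith
      _ = 2 * e / n * ∑ j ∈ Finset.Ico k n, y j := by rw [Finset.mul_sum]
      _ ≤ 2 * e / n * ∑ j ∈ Finset.range n, y j := by
          refine mul_le_mul_of_nonneg_left ?_ (by positivity)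
          rw [Finset.range_eq_Ico]
          exact Finset.sum_le_sum_of_subset_of_nonneg (Finset.Ico_subset_Ico_left (Nat.zero_le _))
            fun j _ _ => hy j
      _ ≤ 2 * e / n * (d * n) := mul_le_mul_of_nonneg_left (hys n) (by positivity)
      _ = 2 * e * d := by field_simp
  calc x n ≤ Real.exp (2 * ∑ j ∈ Finset.Ico k n, b j) * x k := hiter n hk2.le
    _ ≤ Real.exp (4 * e * d) * (2 * c) := by
        refine mul_le_mul (Real.exp_le_exp.mpr (by linarith)) hkx (hx k) (Real.exp_pos _).le
    _ = _ := by ring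

end Predictor

/-! ### A density with one jump: uniform bound on the predictors -/

section Jump

/-- The density on the upper half circle that equals `1 + c` up to the angle `b` and `1` after. -/
def jumpWeight (c b : ℝ) (θ : ℝ) : ℝ := 1 + if θ ≤ b then c else 0

variable {b c : ℝ}

lemma measurable_jumpWeight (c b : ℝ) : Measurable (jumpWeight c b) :=
  measurable_const.add (Measurable.ite measurableSet_Iic measurable_const measurable_const)

lemma one_le_jumpWeight (hc : 0 ≤ c) (θ : ℝ) : 1 ≤ jumpWeight c b θ := by
  unfold jumpWeight
  split_ifs <;> linarith

lemma jumpWeight_le (hc : 0 ≤ c) (θ : ℝ) : jumpWeight c b θ ≤ 1 + c := by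
  unfold jumpWeight
  split_ifs <;> linarith

lemma norm_jumpWeight_le (hc : 0 ≤ c) (θ : ℝ) : ‖jumpWeight c b θ‖ ≤ 1 + c := by
  rw [Real.norm_of_nonneg (zero_le_one.trans (one_le_jumpWeight hc θ))]
  exact jumpWeight_le hc θ

lemma jumpWeight_mul_intervalIntegrable (hc : 0 ≤ c) {f : ℝ → ℝ} {a d : ℝ}
    (hf : IntervalIntegrable f volume a d) :
    IntervalIntegrable (fun θ => jumpWeight c b θ * f θ) volume a d := by
  rw [intervalIntegrable_iff] at hf ⊢
  exact hf.bdd_mul (measurable_jumpWeight c b).aestronglyMeasurable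
    (Eventually.of_forall fun θ => norm_jumpWeight_le hc θ)

lemma jumpWeight_intervalIntegrable (hc : 0 ≤ c) (b a d : ℝ) :
    IntervalIntegrable (jumpWeight c b) volume a d := by
  simpa using jumpWeight_mul_intervalIntegrable (b := b) hc
    (intervalIntegrable_const (c := (1 : ℝ)) (a := a) (b := d) (μ := volume))

lemma integral_jumpWeight_mul (hb0 : 0 ≤ b) (hb : b ≤ Real.pi) {f : ℝ → ℝ}
    (hf : IntervalIntegrable f volume 0 Real.pi) :
    ∫ θ in (0)..Real.pi, jumpWeight c b θ * f θ
      = (∫ θ in (0)..Real.pi, f θ) + c * ∫ θ in (0)..b, f θ := by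
  have hf1 : IntervalIntegrable f volume 0 b :=
    hf.mono_set (by rw [Set.uIcc_of_le hb0, Set.uIcc_of_le Real.pi_pos.le]; gcongr)
  have hf2 : IntervalIntegrable f volume b Real.pi :=
    hf.mono_set (by rw [Set.uIcc_of_le hb, Set.uIcc_of_le Real.pi_pos.le]; gcongr)
  have e1 : Set.EqOn (fun θ => (1 + c) * f θ) (fun θ => jumpWeight c b θ * f θ) (Set.uIoc 0 b) := by
    intro θ hθ
    rw [Set.uIoc_of_le hb0] at hθ
    simp [jumpWeight, hθ.2]
  have e2 : Set.EqOn f (fun θ => jumpWeight c b θ * f θ) (Set.uIoc b Real.pi) := by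
    intro θ hθ
    rw [Set.uIoc_of_le hb] at hθ
    simp [jumpWeight, hθ.1.not_ge]
  have g1 := (hf1.const_mul (1 + c)).congr e1
  have g2 := hf2.congr e2
  rw [← intervalIntegral.integral_add_adjacent_intervals g1 g2,
    ← intervalIntegral.integral_add_adjacent_intervals hf1 hf2,
    ← intervalIntegral.integral_congr_ae (Eventually.of_forall fun θ hθ => e1 hθ),
    ← intervalIntegral.integral_congr_ae (Eventually.of_forall fun θ hθ => e2 hθ),
    intervalIntegral.integral_const_mul]
  ring

lemma hasDerivAt_circleEval (p : ℝ[X]) (θ : ℝ) :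
    HasDerivAt (circleEval p) (Complex.I * circleEval (X * derivative p) θ) θ := by
  have h1 : HasDerivAt (fun t : ℝ => Complex.exp (t * Complex.I))
      (Complex.exp (θ * Complex.I) * (1 * Complex.I)) θ :=
    ((Complex.ofRealCLM.hasDerivAt (x := θ)).mul_const Complex.I).cexp
  have h2 := (p.hasDerivAt_aeval (Complex.exp (θ * Complex.I))).comp θ h1
  refine HasDerivAt.congr_deriv (f := circleEval p) h2 ?_
  rw [circleEval_mul, circleEval_X, circleEval]
  ring

lemma im_circleEval_zero (p : ℝ[X]) : (circleEval p 0).im = 0 := by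
  have : circleEval p 0 = ((p.eval 1 : ℝ) : ℂ) := by
    rw [circleEval]
    simpa using (Polynomial.aeval_algebraMap_apply ℂ (1 : ℝ) p)
  rw [this, Complex.ofReal_im]

lemma im_circleEval_pi (p : ℝ[X]) : (circleEval p Real.pi).im = 0 := by
  have : circleEval p Real.pi = ((p.eval (-1) : ℝ) : ℂ) := by
    rw [circleEval, Complex.exp_pi_mul_I]
    simpa using (Polynomial.aeval_algebraMap_apply ℂ (-1 : ℝ) p)
  rw [this, Complex.ofReal_im]

/-- The integrand is the derivative of the imaginary part of `p · conj q`, which vanishes at angle 0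
because real polynomials are real there. -/
lemma integral_rotation (p q : ℝ[X]) (b : ℝ) :
    ∫ θ in (0)..b, ((circleEval (X * derivative p) θ * conj (circleEval q θ)).re
      - (circleEval p θ * conj (circleEval (X * derivative q) θ)).re)
      = (circleEval p b * conj (circleEval q b)).im := by
  have hd : ∀ θ, HasDerivAt (fun t => (circleEval p t * conj (circleEval q t)).im)
      ((circleEval (X * derivative p) θ * conj (circleEval q θ)).re
      - (circleEval p θ * conj (circleEval (X * derivative q) θ)).re) θ := by
    intro θ
    have h := (hasDerivAt_circleEval p θ).mul
      ((Complex.conjCLE.toContinuousLinearMap.hasFDerivAt.comp_hasDerivAt θ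
        (hasDerivAt_circleEval q θ)))
    have h2 := Complex.imCLM.hasFDerivAt.comp_hasDerivAt θ h
    refine HasDerivAt.congr_deriv
      (f := fun t => (circleEval p t * conj (circleEval q t)).im) h2 ?_
    simp [Complex.mul_re, Complex.mul_im, -circleEval_mul]
    ring
  rw [intervalIntegral.integral_eq_sub_of_hasDerivAt (fun θ _ => hd θ)
    (((continuous_re_mul_conj _ _).sub (continuous_re_mul_conj _ _)).intervalIntegrable _ _)]
  simp [Complex.mul_im, im_circleEval_zero]

/-- Integration by parts for the rotation field `X d/dX`, for a density with one jump. -/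
lemma form_derivative_sub (hc : 0 ≤ c) (hb0 : 0 ≤ b) (hb : b ≤ Real.pi) (p q : ℝ[X]) :
    form (jumpWeight c b) (X * derivative p) q - form (jumpWeight c b) p (X * derivative q)
      = c / Real.pi * (circleEval p b * conj (circleEval q b)).im := by
  have hw := jumpWeight_intervalIntegrable hc b 0 Real.pi
  have hi : IntervalIntegrable (fun θ => (circleEval (X * derivative p) θ * conj (circleEval q θ)).re
      - (circleEval p θ * conj (circleEval (X * derivative q) θ)).re) volume 0 Real.pi :=
    ((continuous_re_mul_conj _ _).sub (continuous_re_mul_conj _ _)).intervalIntegrable _ _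
  unfold form
  rw [← mul_sub, ← intervalIntegral.integral_sub (form_integrable hw _ _) (form_integrable hw _ _)]
  simp only [← mul_sub]
  -- The boundary term at `π` vanishes too, as `p(-1)` and `q(-1)` are real; only the jump at `b`
  -- contributes.
  rw [integral_jumpWeight_mul hb0 hb hi, integral_rotation, integral_rotation]
  simp only [Complex.mul_im, Complex.conj_re, Complex.conj_im, im_circleEval_pi]
  ring

lemma natDegree_X_mul_derivative_le {p : ℝ[X]} {n : ℕ} (hp : p.natDegree ≤ n) :
    (X * derivative p).natDegree ≤ n := by
  rw [natDegree_le_iff_coeff_eq_zero]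
  intro k hk
  obtain ⟨j, rfl⟩ : ∃ j, k = j + 1 := ⟨k - 1, by omega⟩
  rw [coeff_X_mul, coeff_derivative, coeff_eq_zero_of_natDegree_lt (hp.trans_lt hk), zero_mul]

/-- The reflection coefficients of a density with one jump decay like `1 / n`, relative to the
size of the predictor at the jump. -/
lemma IsPredictor.reflection_coeff_le (hc : 0 ≤ c) (hb0 : 0 ≤ b) (hb : b ≤ Real.pi) {n : ℕ}
    {A A' : ℝ[X]} (hA : IsPredictor (jumpWeight c b) n A)
    (hA' : IsPredictor (jumpWeight c b) (n + 1) A') :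
    (n + 1) * |A'.coeff (n + 1)| ≤ 2 * c / Real.pi * ‖circleEval A b‖ ^ 2 := by
  have hw := jumpWeight_intervalIntegrable hc b 0 Real.pi
  have h1 := one_le_jumpWeight (b := b) hc
  set R := X * reflect n A with hR
  have hRdeg : R.natDegree ≤ n + 1 := hA.natDegree_X_mul_reflect_le
  -- With `R = X · reflect n A`, one pairing vanishes by orthogonality of `A'`. The other sees only
  -- the top coefficient of `X · derivative A'`, which supplies the factor `n + 1`.
  have hid := form_derivative_sub hc hb0 hb A' R
  have hz : form (jumpWeight c b) A' (X * derivative R) = 0 :=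
    hA'.form_eq_zero hw (natDegree_X_mul_derivative_le hRdeg) (by simp)
  have hl : form (jumpWeight c b) (X * derivative A') R
      = A'.coeff (n + 1) * (n + 1) * form (jumpWeight c b) A A := by
    rw [form_comm, hA.form_X_mul_reflect_left hw
      (natDegree_X_mul_derivative_le hA'.natDegree_le) (by simp), coeff_X_mul, coeff_derivative]
  rw [hz, hl, sub_zero] at hid
  have hE := hA.one_le hw h1
  have ha := hA.abs_coeff_le_one hw h1 hA'
  have hA'b := hA.norm_circleEval_succ_le hw h1 hA' b
  have hRb : ‖circleEval R b‖ = ‖circleEval A b‖ := by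
    rw [hR, circleEval_mul, norm_mul, circleEval_X, norm_circleEval_X,
      hA.norm_circleEval_reflect, one_mul]
  have hn : (0 : ℝ) ≤ n + 1 := by positivity
  calc (n + 1) * |A'.coeff (n + 1)|
      ≤ (n + 1) * |A'.coeff (n + 1)| * form (jumpWeight c b) A A :=
        le_mul_of_one_le_right (by positivity) hE
    _ = |A'.coeff (n + 1) * (n + 1) * form (jumpWeight c b) A A| := by
        rw [abs_mul, abs_mul, abs_of_nonneg hn, abs_of_nonneg (zero_le_one.trans hE)]
        ring
    _ = c / Real.pi * |(circleEval A' b * conj (circleEval R b)).im| := by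
        rw [hid, abs_mul, abs_of_nonneg (div_nonneg hc Real.pi_pos.le)]
    _ ≤ c / Real.pi * ((2 * ‖circleEval A b‖) * ‖circleEval A b‖) := by
        refine mul_le_mul_of_nonneg_left ?_ (div_nonneg hc Real.pi_pos.le)
        refine (Complex.abs_im_le_norm _).trans ?_
        rw [norm_mul, Complex.norm_conj, hRb]
        refine mul_le_mul_of_nonneg_right (hA'b.trans ?_) (norm_nonneg _)
        exact mul_le_mul_of_nonneg_right (by linarith) (norm_nonneg _)
    _ = _ := by ring

/-- The predictors of a density with one jump are uniformly bounded on the unit circle. -/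
theorem exists_norm_sq_circleEval_le (hc : 0 ≤ c) (hb0 : 0 ≤ b) (hb : b ≤ Real.pi)
    {A : ℕ → ℝ[X]} (hA : ∀ n, IsPredictor (jumpWeight c b) n (A n)) :
    ∃ M : ℝ, ∀ n θ, ‖circleEval (A n) θ‖ ^ 2 ≤ M := by
  have hw := jumpWeight_intervalIntegrable hc b 0 Real.pi
  have h1 := one_le_jumpWeight (b := b) hc
  have hsum := sum_norm_sq_le hw h1 hA
  refine ⟨_, fun n θ => le_of_average_le (x := fun n => ‖circleEval (A n) θ‖ ^ 2)
    (y := fun n => ‖circleEval (A n) b‖ ^ 2) (b := fun n => |(A (n + 1)).coeff (n + 1)|)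
    (c := 2 * form (jumpWeight c b) 1 1) (d := 2 * form (jumpWeight c b) 1 1)
    (e := 2 * c / Real.pi) ?_ (fun n => by positivity) (fun n => by positivity)
    (by have := Real.pi_pos; positivity) (fun n => ?_)
    (fun n => (hA n).reflection_coeff_le hc hb0 hb (hA (n + 1))) (fun n => hsum n θ)
    (fun n => hsum n b) n⟩
  · exact mul_nonneg zero_le_two (form_self_nonneg hw h1 _)
  · have h := (hA n).norm_circleEval_succ_le hw h1 (hA (n + 1)) θ
    have h2 : 1 + |(A (n + 1)).coeff (n + 1)| ≤ Real.exp |(A (n + 1)).coeff (n + 1)| := by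
      rw [add_comm]; exact Real.add_one_le_exp _
    calc ‖circleEval (A (n + 1)) θ‖ ^ 2
        ≤ (Real.exp |(A (n + 1)).coeff (n + 1)| * ‖circleEval (A n) θ‖) ^ 2 := by
          gcongr
          exact h.trans (mul_le_mul_of_nonneg_right h2 (norm_nonneg _))
      _ = _ := by rw [mul_pow, ← Real.exp_nat_mul]; norm_num

end Jump

/-! ### Weak convergence of the weighted squared predictors to a constant -/

section WeakLimit

variable {w : ℝ → ℝ} {b c : ℝ}

lemma form_sq_le (hw : IntervalIntegrable w volume 0 Real.pi) (h1 : ∀ θ, 1 ≤ w θ) (p q : ℝ[X]) :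
    form w p q ^ 2 ≤ form w p p * form w q q :=
  LinearMap.BilinForm.apply_sq_le_of_symm (bilin hw) (form_self_nonneg hw h1)
    ⟨fun p q => form_comm w p q⟩ p q

lemma form_mul_self_le (hw : IntervalIntegrable w volume 0 Real.pi) (h1 : ∀ θ, 1 ≤ w θ)
    {g : ℝ[X]} {G : ℝ} (hG : ∀ θ, ‖circleEval g θ‖ ≤ G) (q : ℝ[X]) :
    form w (g * q) (g * q) ≤ G ^ 2 * form w q q := by
  rw [← sub_nonneg]
  unfold form
  rw [mul_left_comm, ← mul_sub, ← intervalIntegral.integral_const_mul,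
    ← intervalIntegral.integral_sub ((form_integrable hw _ _).const_mul _) (form_integrable hw _ _)]
  refine mul_nonneg (by have := Real.pi_pos; positivity)
    (intervalIntegral.integral_nonneg Real.pi_pos.le fun θ _ => ?_)
  rw [re_mul_conj_self, re_mul_conj_self, circleEval_mul, norm_mul, mul_pow]
  have h2 : ‖circleEval g θ‖ ^ 2 ≤ G ^ 2 := by gcongr; exact hG θ
  have h3 : 0 ≤ w θ * ‖circleEval q θ‖ ^ 2 :=
    mul_nonneg (zero_le_one.trans (h1 θ)) (by positivity)
  nlinarith

lemma exists_norm_circleEval_le (g : ℝ[X]) : ∃ G : ℝ, ∀ θ, ‖circleEval g θ‖ ≤ G := by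
  refine ⟨∑ i ∈ Finset.range (g.natDegree + 1), |g.coeff i|, fun θ => ?_⟩
  rw [circleEval_eq_sum g (Nat.lt_succ_self _)]
  refine (norm_sum_le _ _).trans (Finset.sum_le_sum fun i _ => ?_)
  rw [norm_mul, norm_pow, norm_circleEval_X]
  simp

/-- The prediction errors of a sequence of predictors decrease to a limit. -/
lemma tendsto_predictor_form_self (hw : IntervalIntegrable w volume 0 Real.pi)
    (h1 : ∀ θ, 1 ≤ w θ) {A : ℕ → ℝ[X]} (hA : ∀ n, IsPredictor w n (A n)) :
    Tendsto (fun n => form w (A n) (A n)) atTop (𝓝 (⨅ n, form w (A n) (A n))) := by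
  refine tendsto_atTop_ciInf (antitone_nat_of_succ_le fun n => ?_) ⟨1, ?_⟩
  · exact (hA (n + 1)).form_self_le hw h1 ((hA n).natDegree_le.trans n.le_succ) (hA n).coeff_zero
  · rintro _ ⟨n, rfl⟩
    exact (hA n).one_le hw h1

lemma iInf_predictor_le (hw : IntervalIntegrable w volume 0 Real.pi)
    (h1 : ∀ θ, 1 ≤ w θ) {A : ℕ → ℝ[X]} (hA : ∀ n, IsPredictor w n (A n)) {p : ℝ[X]}
    (hp : p.coeff 0 = 1) : ⨅ n, form w (A n) (A n) ≤ form w p p := by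
  refine (ciInf_le ⟨1, ?_⟩ p.natDegree).trans ((hA _).form_self_le hw h1 le_rfl hp)
  rintro _ ⟨n, rfl⟩
  exact (hA n).one_le hw h1

/-- With `d = natDegree g`, the product `g A_{n-d}` is orthogonal to `A_n`, so `g A_n` may be
replaced by `g (A_n - A_{n-d})`. The squared norm of `A_n - A_{n-d}` is a difference of prediction
errors and tends to 0; Cauchy–Schwarz concludes. -/
lemma tendsto_form_mul_predictor (hw : IntervalIntegrable w volume 0 Real.pi)
    (h1 : ∀ θ, 1 ≤ w θ) {A : ℕ → ℝ[X]} (hA : ∀ n, IsPredictor w n (A n)) {g : ℝ[X]}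
    (hg : g.coeff 0 = 0) :
    Tendsto (fun n => form w (A n) (g * A n)) atTop (𝓝 0) := by
  obtain ⟨G, hG⟩ := exists_norm_circleEval_le g
  have hE := tendsto_predictor_form_self hw h1 hA
  set d := g.natDegree
  have hlim : Tendsto (fun n => form w 1 1 * (G ^ 2 * (form w (A (n - d)) (A (n - d))
      - form w (A n) (A n)))) atTop (𝓝 0) := by
    have := ((hE.comp (tendsto_sub_atTop_nat d)).sub hE).const_mul (G ^ 2)
    simpa using this.const_mul (form w 1 1)
  have hsq : Tendsto (fun n => form w (A n) (g * A n) ^ 2) atTop (𝓝 0) := by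
    refine squeeze_zero' (Eventually.of_forall fun n => sq_nonneg _) ?_ hlim
    filter_upwards [eventually_ge_atTop d] with n hn
    have e1 : form w (A n) (g * A (n - d)) = 0 := by
      refine (hA n).form_eq_zero hw (natDegree_mul_le.trans ?_) (by simp [mul_coeff_zero, hg])
      have := (hA (n - d)).natDegree_le
      omega
    have e2 : form w (A n) (g * A n) = -form w (A n) (g * (A (n - d) - A n)) := by
      rw [mul_sub, form_sub_right hw, e1]
      ring
    rw [e2, neg_sq, ← (hA n).form_sub_self hw ((hA (n - d)).natDegree_le.trans (Nat.sub_le _ _))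
      (hA (n - d)).coeff_zero]
    refine (form_sq_le hw h1 _ _).trans (mul_le_mul ((hA n).form_self_le hw h1 (by simp) (by simp))
      (form_mul_self_le hw h1 hG _) (form_self_nonneg hw h1 _) (form_self_nonneg hw h1 _))
  have := hsq.sqrt
  simp only [Real.sqrt_sq_eq_abs, Real.sqrt_zero] at this
  exact (tendsto_zero_iff_abs_tendsto_zero _).mpr this

/-- A polynomial in `cos θ` is, up to a constant, the real part of a polynomial in `e^{iθ}` without
constant term. -/
lemma exists_eval_cos_eq (U : ℝ[X]) :
    ∃ (u : ℝ) (g : ℝ[X]), g.coeff 0 = 0 ∧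
      ∀ θ, U.eval (Real.cos θ) = u + (circleEval g θ).re := by
  induction U using Polynomial.induction_on' with
  | add p q hp hq =>
    obtain ⟨u, g, hg, h⟩ := hp
    obtain ⟨u', g', hg', h'⟩ := hq
    refine ⟨u + u', g + g', by simp [hg, hg'], fun θ => ?_⟩
    rw [eval_add, h, h', circleEval_add, Complex.add_re]
    ring
  | monomial n a =>
    induction n with
    | zero => exact ⟨a, 0, by simp, fun θ => by simp [circleEval]⟩
    | succ n ih =>
      obtain ⟨u, g, hg, h⟩ := ih
      -- `cos θ · Re g` is half the real part of `z g + conj z · g`. The second term is `g.divX`,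
      -- whose constant coefficient moves into the new constant.
      refine ⟨g.divX.coeff 0 / 2,
        u • X + (1 / 2 : ℝ) • (X * g + (g.divX - C (g.divX.coeff 0))), by simp, fun θ => ?_⟩
      have hz := exp_mul_conj_exp θ
      have hgz : circleEval g θ = Complex.exp (θ * Complex.I) * circleEval g.divX θ := by
        conv_lhs => rw [← g.X_mul_divX_add, hg, C_0, add_zero]
        rw [circleEval_mul, circleEval_X]
      have hd : circleEval g.divX θ = conj (Complex.exp (θ * Complex.I)) * circleEval g θ := by
        rw [hgz]
        linear_combination (-circleEval g.divX θ) * hz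
      have e : (monomial (n + 1) a).eval (Real.cos θ)
          = Real.cos θ * (monomial n a).eval (Real.cos θ) := by
        simp only [eval_monomial]
        ring
      rw [e, h]
      simp only [circleEval_add, circleEval_smul, circleEval_mul, circleEval_sub, circleEval_C,
        circleEval_X, hd, Complex.add_re, Complex.sub_re, Complex.ofReal_re, Complex.ofReal_im,
        Complex.mul_re, Complex.conj_re, Complex.conj_im, Complex.exp_ofReal_mul_I_re,
        Complex.exp_ofReal_mul_I_im]
      ring

lemma form_one_one_left (g : ℝ[X]) : form (fun _ => 1) 1 g = g.coeff 0 := by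
  rw [form_eq_sum_right one_intervalIntegrable _ (Nat.lt_succ_self _)]
  have : (1 : ℝ[X]) = X ^ 0 := by simp
  simp only [this, form_one_monomials, mul_ite, mul_one, mul_zero]
  rw [Finset.sum_ite_eq, if_pos (by simp)]

lemma integral_eval_cos {U g : ℝ[X]} {u : ℝ} (hg : g.coeff 0 = 0)
    (h : ∀ θ, U.eval (Real.cos θ) = u + (circleEval g θ).re) :
    1 / Real.pi * ∫ θ in (0)..Real.pi, U.eval (Real.cos θ) = u := by
  have h1 := form_one_one_left g
  rw [hg, form] at h1
  simp only [circleEval_one, one_mul, Complex.conj_re] at h1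
  have hcont : Continuous fun θ => (circleEval g θ).re :=
    Complex.continuous_re.comp (continuous_circleEval g)
  simp only [h]
  rw [intervalIntegral.integral_add intervalIntegrable_const (hcont.intervalIntegrable _ _),
    mul_add, h1]
  simp

/-- Polynomials in `cos θ` are dense in `L¹(0, π)`. -/
lemma exists_integral_abs_sub_eval_cos_le {g : ℝ → ℝ}
    (hg : IntervalIntegrable g volume 0 Real.pi) {ε : ℝ} (hε : 0 < ε) :
    ∃ U : ℝ[X], ∫ θ in (0)..Real.pi, |g θ - U.eval (Real.cos θ)| ≤ ε := by
  have hg' := (intervalIntegrable_iff_integrableOn_Ioc_of_le Real.pi_pos.le).mp hg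
  obtain ⟨v, -, hv1, hv2, hv3⟩ := Integrable.exists_hasCompactSupport_integral_sub_le
    (μ := volume.restrict (Set.Ioc 0 Real.pi)) hg' (half_pos hε)
  -- The substitution `x = cos θ` reduces the approximation to Weierstrass on `[-1, 1]`.
  have hV : ContinuousOn (fun x => v (Real.arccos x)) (Set.Icc (-1) 1) :=
    (hv2.comp Real.continuous_arccos).continuousOn
  have hδ : 0 < ε / 2 / Real.pi := div_pos (half_pos hε) Real.pi_pos
  obtain ⟨U, hU⟩ := exists_polynomial_near_of_continuousOn (-1) 1 _ hV _ hδ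
  refine ⟨U, ?_⟩
  have hcU : Continuous fun θ => U.eval (Real.cos θ) := by fun_prop
  have i1 : IntervalIntegrable (fun θ => |g θ - v θ|) volume 0 Real.pi :=
    (hg.sub (hv2.intervalIntegrable _ _)).abs
  have i2 : IntervalIntegrable (fun θ => |g θ - U.eval (Real.cos θ)|) volume 0 Real.pi :=
    (hg.sub (hcU.intervalIntegrable _ _)).abs
  calc ∫ θ in (0)..Real.pi, |g θ - U.eval (Real.cos θ)|
      ≤ ∫ θ in (0)..Real.pi, (|g θ - v θ| + ε / 2 / Real.pi) := by
        refine intervalIntegral.integral_mono_on Real.pi_pos.le i2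
          (i1.add intervalIntegrable_const) fun θ hθ => ?_
        have h1 := hU (Real.cos θ) ⟨Real.neg_one_le_cos θ, Real.cos_le_one θ⟩
        simp only [Real.arccos_cos hθ.1 hθ.2] at h1
        rw [abs_sub_comm] at h1
        have h2 := abs_sub_le (g θ) (v θ) (U.eval (Real.cos θ))
        linarith
    _ = (∫ θ in (0)..Real.pi, |g θ - v θ|) + ε / 2 := by
        rw [intervalIntegral.integral_add i1 intervalIntegrable_const]
        have := Real.pi_ne_zero
        simp
        field_simp
    _ ≤ ε := by
        rw [intervalIntegral.integral_of_le Real.pi_pos.le]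
        simp only [Real.norm_eq_abs] at hv1
        linarith

/-- If the functions `w |A_n|²` are uniformly bounded, then they converge to a constant, weakly
against integrable functions. -/
theorem tendsto_integral_predictor_mul (hw : IntervalIntegrable w volume 0 Real.pi)
    (h1 : ∀ θ, 1 ≤ w θ) (hwm : Measurable w) {A : ℕ → ℝ[X]} (hA : ∀ n, IsPredictor w n (A n))
    {K : ℝ} (hK : ∀ n θ, w θ * ‖circleEval (A n) θ‖ ^ 2 ≤ K) {g : ℝ → ℝ}
    (hg : IntervalIntegrable g volume 0 Real.pi) :
    Tendsto (fun n => ∫ θ in (0)..Real.pi, w θ * ‖circleEval (A n) θ‖ ^ 2 * g θ) atTop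
      (𝓝 ((⨅ n, form w (A n) (A n)) * ∫ θ in (0)..Real.pi, g θ)) := by
  set e := ⨅ n, form w (A n) (A n) with he
  set F : ℕ → ℝ → ℝ := fun n θ => w θ * ‖circleEval (A n) θ‖ ^ 2 with hF
  have hF0 : ∀ n θ, 0 ≤ F n θ := fun n θ =>
    mul_nonneg (zero_le_one.trans (h1 θ)) (by positivity)
  have hFm : ∀ n, Measurable (F n) := fun n =>
    hwm.mul (((continuous_circleEval (A n)).norm.pow 2).measurable)
  have hFi : ∀ n {f : ℝ → ℝ}, IntervalIntegrable f volume 0 Real.pi →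
      IntervalIntegrable (fun θ => F n θ * f θ) volume 0 Real.pi := fun n f hf => by
    rw [intervalIntegrable_iff] at hf ⊢
    exact hf.bdd_mul (hFm n).aestronglyMeasurable
      (Eventually.of_forall fun θ => (Real.norm_of_nonneg (hF0 n θ)).trans_le (hK n θ))
  have hK0 : 0 ≤ K := (hF0 0 0).trans (hK 0 0)
  -- Write `U(cos θ) = u + Re p` with `p(0) = 0`: the mean `u` multiplies the prediction error, and
  -- the `p` part tends to 0.
  have htrig : ∀ U : ℝ[X], Tendsto (fun n => ∫ θ in (0)..Real.pi, F n θ * U.eval (Real.cos θ)) atTop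
      (𝓝 (e * ∫ θ in (0)..Real.pi, U.eval (Real.cos θ))) := by
    intro U
    obtain ⟨u, p, hp, hU⟩ := exists_eval_cos_eq U
    have hint := integral_eval_cos hp hU
    have hlim := (((tendsto_predictor_form_self hw h1 hA).const_mul u).add
      (tendsto_form_mul_predictor hw h1 hA hp)).const_mul Real.pi
    have hpi := Real.pi_ne_zero
    have e1 : Real.pi * (u * e + 0) = e * ∫ θ in (0)..Real.pi, U.eval (Real.cos θ) := by
      rw [← hint]; field_simp; ring
    rw [e1] at hlim
    refine hlim.congr fun n => ?_
    rw [form_self, form, mul_left_comm u, ← mul_add, ← mul_assoc, mul_one_div_cancel hpi, one_mul,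
      ← intervalIntegral.integral_const_mul, ← intervalIntegral.integral_add]
    · refine intervalIntegral.integral_congr fun θ _ => ?_
      have e2 : (circleEval (A n) θ * conj (circleEval (p * A n) θ)).re
          = ‖circleEval (A n) θ‖ ^ 2 * (circleEval p θ).re := by
        rw [circleEval_mul, map_mul, mul_left_comm, Complex.mul_conj, Complex.normSq_eq_norm_sq,
          mul_comm, Complex.re_ofReal_mul, Complex.conj_re]
      simp only [hF, e2, hU]
      ring
    · have := (form_integrable hw (A n) (A n)).const_mul u
      simpa only [re_mul_conj_self] using this
    · exact form_integrable hw _ _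
  rw [Metric.tendsto_atTop]
  intro ε hε
  have he0 : 0 ≤ e := Real.iInf_nonneg fun n => form_self_nonneg hw h1 _
  set δ := ε / (3 * (K + e + 1)) with hδ
  have hδ0 : 0 < δ := by positivity
  have hδε : (K + e + 1) * δ = ε / 3 := by rw [hδ]; field_simp
  obtain ⟨U, hU⟩ := exists_integral_abs_sub_eval_cos_le hg hδ0
  have hUi : IntervalIntegrable (fun θ => U.eval (Real.cos θ)) volume 0 Real.pi :=
    Continuous.intervalIntegrable (by fun_prop) _ _
  obtain ⟨N, hN⟩ := Metric.tendsto_atTop.mp (htrig U) (ε / 3) (by positivity)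
  refine ⟨N, fun n hn => ?_⟩
  have hn' := hN n hn
  rw [Real.dist_eq] at hn' ⊢
  have b1 : |(∫ θ in (0)..Real.pi, F n θ * g θ)
      - ∫ θ in (0)..Real.pi, F n θ * U.eval (Real.cos θ)| ≤ K * δ := by
    rw [← intervalIntegral.integral_sub (hFi n hg) (hFi n hUi)]
    refine (intervalIntegral.abs_integral_le_integral_abs Real.pi_pos.le).trans ?_
    refine le_trans ?_ (mul_le_mul_of_nonneg_left hU hK0)
    rw [← intervalIntegral.integral_const_mul]
    refine intervalIntegral.integral_mono Real.pi_pos.le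
      ((hFi n hg).sub (hFi n hUi)).abs ((hg.sub hUi).abs.const_mul K) fun θ => ?_
    simp only [← mul_sub, abs_mul, abs_of_nonneg (hF0 n θ)]
    exact mul_le_mul_of_nonneg_right (hK n θ) (abs_nonneg _)
  have b2 : |e * (∫ θ in (0)..Real.pi, U.eval (Real.cos θ)) - e * ∫ θ in (0)..Real.pi, g θ|
      ≤ e * δ := by
    rw [← mul_sub, abs_mul, abs_of_nonneg he0, abs_sub_comm, ← intervalIntegral.integral_sub hg hUi]
    exact mul_le_mul_of_nonneg_left
      ((intervalIntegral.abs_integral_le_integral_abs Real.pi_pos.le).trans hU) he0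
  rw [abs_le] at b1 b2
  rw [abs_lt] at hn' ⊢
  constructor <;> nlinarith

end WeakLimit

/-! ### The upper bound in Szegő's theorem -/

section Szego

variable {w : ℝ → ℝ} {b c : ℝ}

/-- The competitors are the Taylor sums of `exp(-g/2)`: their constant term is 1 because `g(0) = 0`,
and `|exp(-g/2)|² = exp(-Re g)`. -/
lemma iInf_predictor_le_integral_exp (hw : IntervalIntegrable w volume 0 Real.pi)
    (h1 : ∀ θ, 1 ≤ w θ) {A : ℕ → ℝ[X]} (hA : ∀ n, IsPredictor w n (A n)) {g : ℝ[X]}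
    (hg : g.coeff 0 = 0) :
    ⨅ n, form w (A n) (A n)
      ≤ 1 / Real.pi * ∫ θ in (0)..Real.pi, w θ * Real.exp (-(circleEval g θ).re) := by
  set q : ℝ[X] := (-(1 / 2) : ℝ) • g with hq
  set T : ℕ → ℝ[X] := fun N => ∑ j ∈ Finset.range N, ((Nat.factorial j : ℝ)⁻¹) • q ^ j with hT
  have hT0 : ∀ N, (T (N + 1)).coeff 0 = 1 := by
    intro N
    have hq0 : q.coeff 0 = 0 := by simp [hq, hg]
    rw [coeff_zero_eq_eval_zero] at hq0 ⊢
    simp [hT, eval_finsetSum, Finset.sum_range_succ', hq0]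
  have hTev : ∀ N θ, circleEval (T N) θ
      = ∑ j ∈ Finset.range N, ((Nat.factorial j : ℂ)⁻¹) • circleEval q θ ^ j := by
    intro N θ
    simp [hT, circleEval, map_sum]
  have hexp : ∀ θ, HasSum (fun j : ℕ => ((Nat.factorial j : ℂ)⁻¹) • circleEval q θ ^ j)
      (Complex.exp (circleEval q θ)) := by
    intro θ
    rw [Complex.exp_eq_exp_ℂ]
    exact NormedSpace.exp_series_hasSum_exp' (𝕂 := ℂ) (circleEval q θ)
  obtain ⟨G, hG⟩ := exists_norm_circleEval_le q
  have hTle : ∀ N θ, ‖circleEval (T N) θ‖ ≤ Real.exp G := by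
    intro N θ
    rw [hTev]
    refine (norm_sum_le _ _).trans ?_
    calc ∑ j ∈ Finset.range N, ‖((Nat.factorial j : ℂ)⁻¹) • circleEval q θ ^ j‖
        ≤ ∑ j ∈ Finset.range N, G ^ j / Nat.factorial j := by
          refine Finset.sum_le_sum fun j _ => ?_
          rw [norm_smul, norm_inv, norm_pow, Complex.norm_natCast, div_eq_inv_mul]
          gcongr
          exact hG θ
      _ ≤ Real.exp G := Real.sum_le_exp_of_nonneg ((norm_nonneg _).trans (hG 0)) N
  have hlim : Tendsto (fun N => form w (T (N + 1)) (T (N + 1))) atTop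
      (𝓝 (1 / Real.pi * ∫ θ in (0)..Real.pi, w θ * Real.exp (-(circleEval g θ).re))) := by
    simp only [form_self]
    refine Tendsto.const_mul _ (intervalIntegral.tendsto_integral_filter_of_dominated_convergence
      (fun θ => w θ * Real.exp G ^ 2) (Eventually.of_forall fun N => ?_)
      (Eventually.of_forall fun N => Eventually.of_forall fun θ _ => ?_) (hw.mul_const _)
      (Eventually.of_forall fun θ _ => ?_))
    · have := form_integrable hw (T (N + 1)) (T (N + 1))
      simp only [re_mul_conj_self] at this
      exact this.def'.aestronglyMeasurable
    · have := zero_le_one.trans (h1 θ)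
      rw [Real.norm_of_nonneg (by positivity)]
      gcongr
      exact hTle _ θ
    · have h2 := ((hexp θ).tendsto_sum_nat.comp (tendsto_add_atTop_nat 1)).norm.pow 2
      have e : ‖Complex.exp (circleEval q θ)‖ ^ 2 = Real.exp (-(circleEval g θ).re) := by
        rw [Complex.norm_exp, ← Real.exp_nat_mul, hq, circleEval_smul, Complex.re_ofReal_mul]
        congr 1
        push_cast
        ring
      rw [e] at h2
      refine Tendsto.const_mul _ (h2.congr fun N => ?_)
      simp only [Function.comp_apply, hTev]
  exact ge_of_tendsto' hlim fun N => iInf_predictor_le hw h1 hA (hT0 N)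

/-- Choose `g` so that `Re g` is within `ε` of `V(cos θ)` minus a constant `u`, itself at most the
mean of `V(cos θ)` plus `ε`. Then `w exp(-Re g)` is at most `exp(u + ε)`. -/
lemma iInf_predictor_le_exp_integral (hw : IntervalIntegrable w volume 0 Real.pi)
    (h1 : ∀ θ, 1 ≤ w θ) {A : ℕ → ℝ[X]} (hA : ∀ n, IsPredictor w n (A n)) {V : ℝ → ℝ}
    (hV : Continuous V) (hVw : ∀ θ ∈ Set.Icc 0 Real.pi, w θ ≤ Real.exp (V (Real.cos θ))) :
    ⨅ n, form w (A n) (A n)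
      ≤ Real.exp (1 / Real.pi * ∫ θ in (0)..Real.pi, V (Real.cos θ)) := by
  have key : ∀ ε > 0, ⨅ n, form w (A n) (A n)
      ≤ Real.exp (1 / Real.pi * (∫ θ in (0)..Real.pi, V (Real.cos θ)) + 2 * ε) := by
    intro ε hε
    obtain ⟨U, hU⟩ := exists_polynomial_near_of_continuousOn (-1) 1 V hV.continuousOn ε hε
    obtain ⟨u, g, hg, h⟩ := exists_eval_cos_eq U
    have hu := integral_eval_cos hg h
    have hcos : ∀ θ, |U.eval (Real.cos θ) - V (Real.cos θ)| < ε := fun θ =>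
      hU _ ⟨Real.neg_one_le_cos θ, Real.cos_le_one θ⟩
    have hVi : IntervalIntegrable (fun θ => V (Real.cos θ)) volume 0 Real.pi :=
      (hV.comp Real.continuous_cos).intervalIntegrable _ _
    have hpi := Real.pi_pos
    have hle : u ≤ 1 / Real.pi * (∫ θ in (0)..Real.pi, V (Real.cos θ)) + ε := by
      have hmono : ∫ θ in (0)..Real.pi, U.eval (Real.cos θ)
          ≤ ∫ θ in (0)..Real.pi, (V (Real.cos θ) + ε) :=
        intervalIntegral.integral_mono hpi.le (Continuous.intervalIntegrable (by fun_prop) _ _)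
          (hVi.add intervalIntegrable_const) fun θ => by
            have := abs_lt.mp (hcos θ)
            simp only
            linarith
      rw [intervalIntegral.integral_add hVi intervalIntegrable_const,
        intervalIntegral.integral_const, sub_zero, smul_eq_mul] at hmono
      have h3 := mul_le_mul_of_nonneg_left hmono (one_div_pos.mpr hpi).le
      rw [hu, mul_add] at h3
      refine h3.trans (le_of_eq ?_)
      field_simp
    refine (iInf_predictor_le_integral_exp hw h1 hA hg).trans ?_
    have hcg : Continuous fun θ => Real.exp (-(circleEval g θ).re) := by
      have := continuous_circleEval g
      fun_prop
    calc 1 / Real.pi * ∫ θ in (0)..Real.pi, w θ * Real.exp (-(circleEval g θ).re)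
        ≤ 1 / Real.pi * ∫ θ in (0)..Real.pi, Real.exp (u + ε) := by
          refine mul_le_mul_of_nonneg_left ?_ (one_div_pos.mpr hpi).le
          refine intervalIntegral.integral_mono_on hpi.le (hw.mul_continuousOn hcg.continuousOn)
            intervalIntegrable_const fun θ hθ => ?_
          have h4 := abs_lt.mp (hcos θ)
          have h5 := h θ
          calc w θ * Real.exp (-(circleEval g θ).re)
              ≤ Real.exp (V (Real.cos θ)) * Real.exp (-(circleEval g θ).re) :=
                mul_le_mul_of_nonneg_right (hVw θ hθ) (Real.exp_pos _).le
            _ ≤ Real.exp (u + ε) := by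
                rw [← Real.exp_add]
                exact Real.exp_le_exp.mpr (by linarith)
      _ = Real.exp (u + ε) := by
          rw [intervalIntegral.integral_const, sub_zero, smul_eq_mul]
          field_simp
      _ ≤ _ := Real.exp_le_exp.mpr (by linarith)
  have hlim : Tendsto (fun ε : ℝ =>
      Real.exp (1 / Real.pi * (∫ θ in (0)..Real.pi, V (Real.cos θ)) + 2 * ε)) (𝓝[>] 0)
      (𝓝 (Real.exp (1 / Real.pi * (∫ θ in (0)..Real.pi, V (Real.cos θ)) + 2 * 0))) :=
    (Continuous.tendsto (by fun_prop) 0).mono_left nhdsWithin_le_nhds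
  rw [mul_zero, add_zero] at hlim
  exact ge_of_tendsto hlim (eventually_mem_nhdsWithin.mono fun ε hε => key ε hε)

/-- The Szegő bound for the limiting prediction error of a density with one jump. -/
theorem iInf_predictor_jumpWeight_le (hc : 0 ≤ c) (hb0 : 0 ≤ b) (hb : b ≤ Real.pi)
    {A : ℕ → ℝ[X]} (hA : ∀ n, IsPredictor (jumpWeight c b) n (A n)) :
    ⨅ n, form (jumpWeight c b) (A n) (A n) ≤ (1 + c) ^ (b / Real.pi) := by
  have hw := jumpWeight_intervalIntegrable hc b 0 Real.pi
  have h1 := one_le_jumpWeight (b := b) hc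
  have hc1 : 0 < 1 + c := by linarith
  have hlog : 0 ≤ Real.log (1 + c) := Real.log_nonneg (by linarith)
  have hcos : ∀ {θ}, θ ∈ Set.Icc 0 Real.pi → θ ≤ b → Real.cos b ≤ Real.cos θ := fun hθ h =>
    Real.strictAntiOn_cos.antitoneOn hθ ⟨hb0, hb⟩ h
  -- Continuous majorants of `log w` in the variable `cos θ`: the jump is replaced by a ramp of
  -- width `1/k` lying outside the band.
  set V : ℕ → ℝ → ℝ := fun k x =>
    Real.log (1 + c) * max 0 (min 1 (1 + k * (x - Real.cos b))) with hV
  have hVc : ∀ k, Continuous (V k) := fun k => by simp only [hV]; fun_prop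
  have hVw : ∀ k, ∀ θ ∈ Set.Icc 0 Real.pi,
      jumpWeight c b θ ≤ Real.exp (V k (Real.cos θ)) := by
    intro k θ hθ
    unfold jumpWeight
    split_ifs with h
    · have h2 : (1 : ℝ) ≤ 1 + k * (Real.cos θ - Real.cos b) :=
        le_add_of_nonneg_right (mul_nonneg (Nat.cast_nonneg k) (sub_nonneg.mpr (hcos hθ h)))
      simp only [hV]
      rw [min_eq_left h2, max_eq_right zero_le_one, mul_one, Real.exp_log hc1]
    · rw [add_zero]
      exact Real.one_le_exp (mul_nonneg hlog (le_max_left _ _))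
  -- The limit integrand is `log w`, written as a jump weight minus 1 so that
  -- `integral_jumpWeight_mul` evaluates it.
  have hlim : Tendsto (fun k => ∫ θ in (0)..Real.pi, V k (Real.cos θ)) atTop
      (𝓝 (∫ θ in (0)..Real.pi, (jumpWeight (Real.log (1 + c)) b θ - 1))) := by
    refine intervalIntegral.tendsto_integral_filter_of_dominated_convergence
      (fun _ => Real.log (1 + c)) (Eventually.of_forall fun k => ?_)
      (Eventually.of_forall fun k => Eventually.of_forall fun θ _ => ?_) intervalIntegrable_const
      (Eventually.of_forall fun θ hθ => ?_)
    · exact ((hVc k).comp Real.continuous_cos).aestronglyMeasurable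
    · rw [Real.norm_of_nonneg (mul_nonneg hlog (le_max_left _ _))]
      exact mul_le_of_le_one_right hlog (max_le zero_le_one (min_le_left _ _))
    · rw [Set.uIoc_of_le Real.pi_pos.le] at hθ
      have hθ' : θ ∈ Set.Icc 0 Real.pi := ⟨hθ.1.le, hθ.2⟩
      unfold jumpWeight
      split_ifs with h
      · refine tendsto_const_nhds.congr fun k => ?_
        have h2 : (1 : ℝ) ≤ 1 + k * (Real.cos θ - Real.cos b) :=
          le_add_of_nonneg_right (mul_nonneg (Nat.cast_nonneg k) (sub_nonneg.mpr (hcos hθ' h)))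
        simp only [hV]
        rw [min_eq_left h2, max_eq_right zero_le_one]
        ring
      · have hlt : Real.cos θ < Real.cos b :=
          Real.strictAntiOn_cos ⟨hb0, hb⟩ hθ' (not_le.mp h)
        obtain ⟨N, hN⟩ := exists_nat_gt (1 / (Real.cos b - Real.cos θ))
        refine tendsto_const_nhds.congr' ?_
        filter_upwards [eventually_ge_atTop N] with k hk
        have hk' : (N : ℝ) ≤ k := by exact_mod_cast hk
        have h3 : 1 ≤ k * (Real.cos b - Real.cos θ) := by
          rw [← div_le_iff₀ (sub_pos.mpr hlt)]
          linarith
        simp only [hV]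
        rw [max_eq_left ((min_le_right _ _).trans (by linarith))]
        ring
  have hval : ∫ θ in (0)..Real.pi, (jumpWeight (Real.log (1 + c)) b θ - 1)
      = Real.log (1 + c) * b := by
    have h2 := integral_jumpWeight_mul (c := Real.log (1 + c)) hb0 hb
      (intervalIntegrable_const (c := (1 : ℝ)))
    simp only [mul_one] at h2
    rw [intervalIntegral.integral_sub (jumpWeight_intervalIntegrable hlog b _ _)
      intervalIntegrable_const, h2]
    simp
  rw [hval] at hlim
  have hlim2 := (Real.continuous_exp.tendsto _).comp (hlim.const_mul (1 / Real.pi))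
  refine (ge_of_tendsto' hlim2 fun k =>
    iInf_predictor_le_exp_integral hw h1 hA (hVc k) (hVw k)).trans (le_of_eq ?_)
  rw [Real.rpow_def_of_pos hc1]
  congr 1
  ring

end Szego

/-! ### Prediction error as a spectral form -/

section Spectral

/-- The even part of a density. -/
def evenPart (S : ℝ → ℝ) (θ : ℝ) : ℝ := (S θ + S (-θ)) / 2

/-- The prediction error polynomial `1 - ∑ h_i X^i` of a filter. -/
def errorPoly {p : ℕ} (h : Fin p → ℝ) : ℝ[X] := 1 - ∑ i : Fin p, h i • X ^ ((i : ℕ) + 1)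

lemma errorPoly_coeff_zero {p : ℕ} (h : Fin p → ℝ) : (errorPoly h).coeff 0 = 1 := by
  simp [errorPoly, coeff_X_pow]

lemma errorPoly_coeff_succ {p : ℕ} (h : Fin p → ℝ) (i : Fin p) :
    (errorPoly h).coeff (i + 1) = -h i := by
  simp [errorPoly, coeff_X_pow, coeff_one, Fin.val_inj]

lemma errorPoly_natDegree_le {p : ℕ} (h : Fin p → ℝ) : (errorPoly h).natDegree ≤ p := by
  refine (natDegree_sub_le _ _).trans (max_le (by simp) ?_)
  refine natDegree_sum_le_of_forall_le _ _ fun i _ => (natDegree_smul_le _ _).trans ?_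
  rw [natDegree_X_pow]
  exact i.2

section Covariance

variable {Ω : Type*} [MeasurableSpace Ω] {P : Measure Ω}
  {X Z : ℤ → Ω → ℝ} {S : ℝ → ℝ}

lemma IsPSD.evenPart_integrable (hS : IsPSD P X S) :
    IntervalIntegrable (evenPart S) volume 0 Real.pi := by
  have h := hS.integrable
  have hpi := Real.pi_pos
  have h1 : IntervalIntegrable S volume (-Real.pi) Real.pi := by
    rw [intervalIntegrable_iff_integrableOn_Icc_of_le (by linarith)]
    exact h
  have h2 : IntervalIntegrable S volume 0 Real.pi := h1.mono_set (by
    rw [Set.uIcc_of_le hpi.le, Set.uIcc_of_le (by linarith)]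
    exact Set.Icc_subset_Icc_left (by linarith))
  have h3 : IntervalIntegrable S volume 0 (-Real.pi) := h1.mono_set (by
    rw [Set.uIcc_of_ge (by linarith), Set.uIcc_of_le (by linarith)]
    exact Set.Icc_subset_Icc_right (by linarith))
  have h4 : IntervalIntegrable (fun θ => S (-θ)) volume 0 Real.pi := by
    have := (IntervalIntegrable.iff_comp_neg).mp h3
    simpa using this
  exact (h2.add h4).div_const 2

/-- The autocovariance is real, so only the cosine part survives, and negative frequencies fold onto
`[0, π]`. No evenness of `S` is needed. -/
lemma IsPSD.autocov_eq_integral (hS : IsPSD P X S) (n r : ℤ) :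
    ∫ ω, X n ω * X (n - r) ω ∂P
      = 1 / Real.pi * ∫ θ in (0)..Real.pi, evenPart S θ * Real.cos (r * θ) := by
  have hpi := Real.pi_pos
  have h1 : IntervalIntegrable S volume (-Real.pi) Real.pi := by
    rw [intervalIntegrable_iff_integrableOn_Icc_of_le (by linarith)]
    exact hS.integrable
  have hcos : Continuous fun θ : ℝ => Real.cos (r * θ) := by fun_prop
  have hi : IntervalIntegrable (fun w => S w * Real.cos (r * w)) volume (-Real.pi) Real.pi :=
    h1.mul_continuousOn hcos.continuousOn
  have hi1 : IntervalIntegrable (fun w => S w * Real.cos (r * w)) volume (-Real.pi) 0 :=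
    hi.mono_set (by
      rw [Set.uIcc_of_le (by linarith), Set.uIcc_of_le (by linarith)]
      exact Set.Icc_subset_Icc_right hpi.le)
  have hi2 : IntervalIntegrable (fun w => S w * Real.cos (r * w)) volume 0 Real.pi :=
    hi.mono_set (by
      rw [Set.uIcc_of_le hpi.le, Set.uIcc_of_le (by linarith)]
      exact Set.Icc_subset_Icc_left (by linarith))
  have hi3 : IntervalIntegrable (fun w => S (-w) * Real.cos (r * w)) volume 0 Real.pi := by
    have := (IntervalIntegrable.iff_comp_neg).mp hi1.symm
    simpa using this
  have hic : IntervalIntegrable (fun w : ℝ => (S w : ℂ) * Complex.exp (Complex.I * r * w)) volume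
      (-Real.pi) Real.pi := by
    refine IntervalIntegrable.mul_continuousOn ?_ (Continuous.continuousOn (by fun_prop))
    rw [intervalIntegrable_iff] at h1 ⊢
    exact h1.ofReal
  have hre := congrArg Complex.re (hS.autocov_eq n r)
  have e0 : 1 / (2 * (Real.pi : ℂ)) = ((1 / (2 * Real.pi) : ℝ) : ℂ) := by push_cast; rfl
  rw [Complex.ofReal_re, e0, Complex.re_ofReal_mul, ← Complex.reCLM_apply,
    ← Complex.reCLM.intervalIntegral_comp_comm hic] at hre
  have e1 : ∀ w : ℝ, Complex.reCLM ((S w : ℂ) * Complex.exp (Complex.I * r * w))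
      = S w * Real.cos (r * w) := by
    intro w
    have : Complex.I * r * w = ((r * w : ℝ) : ℂ) * Complex.I := by push_cast; ring
    rw [this, Complex.reCLM_apply, Complex.re_ofReal_mul, Complex.exp_ofReal_mul_I_re]
  simp only [e1] at hre
  have e2 : ∫ w in (-Real.pi)..0, S w * Real.cos (r * w)
      = ∫ w in (0)..Real.pi, S (-w) * Real.cos (r * w) := by
    have := intervalIntegral.integral_comp_neg (a := 0) (b := Real.pi)
      (fun w => S w * Real.cos (r * w))
    simp only [neg_zero] at this
    rw [← this]
    simp
  rw [hre, ← intervalIntegral.integral_add_adjacent_intervals hi1 hi2, e2,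
    ← intervalIntegral.integral_add hi3 hi2, one_div_mul_eq_div, one_div_mul_eq_div,
    div_eq_div_iff (by positivity) (by positivity), ← intervalIntegral.integral_mul_const,
    ← intervalIntegral.integral_mul_const]
  refine intervalIntegral.integral_congr fun θ _ => ?_
  simp only [evenPart]
  ring

lemma IsQuantizationNoise.aemeasurable (hZ : IsQuantizationNoise P X Z) (n : ℤ) :
    AEMeasurable (Z n) P :=
  pdf.IsUniform.aemeasurable (by simp) (by simp) (hZ.uniform n)

lemma IsQuantizationNoise.integral_comp (hZ : IsQuantizationNoise P X Z) (n : ℤ) {f : ℝ → ℝ}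
    (hf : Continuous f) : ∫ ω, f (Z n ω) ∂P = ∫ z in (-1)..0, f z := by
  have h := integral_map (hZ.aemeasurable n) (f := f) hf.aestronglyMeasurable
  rw [← h, hZ.uniform n, ProbabilityTheory.cond, intervalIntegral.integral_of_le (by norm_num),
    integral_Ioc_eq_integral_Ioo, ← integral_Ico_eq_integral_Ioo]
  simp

lemma IsQuantizationNoise.integral_eq_zero (hZ : IsQuantizationNoise P X Z) (n : ℤ) :
    ∫ ω, (Z n ω + 1 / 2) ∂P = 0 := by
  rw [hZ.integral_comp n (f := fun z => z + 1 / 2) (by fun_prop),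
    intervalIntegral.integral_add (by simp) (by simp)]
  simp
  norm_num

lemma IsQuantizationNoise.integral_sq (hZ : IsQuantizationNoise P X Z) (n : ℤ) :
    ∫ ω, (Z n ω + 1 / 2) * (Z n ω + 1 / 2) ∂P = 1 / 12 := by
  rw [hZ.integral_comp n (f := fun z => (z + 1 / 2) * (z + 1 / 2)) (by fun_prop)]
  have := intervalIntegral.integral_comp_add_right (a := (-1 : ℝ)) (b := 0)
    (fun z : ℝ => z ^ 2) (1 / 2)
  simp only [sq] at this
  rw [this]
  simp only [← sq]
  rw [integral_pow]
  norm_num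

variable [IsProbabilityMeasure P]

lemma IsQuantizationNoise.memLp (hZ : IsQuantizationNoise P X Z) (n : ℤ) :
    MemLp (fun ω => Z n ω + 1 / 2) 2 P := by
  have hmem : ∀ᵐ ω ∂P, Z n ω ∈ Set.Ico (-1 : ℝ) 0 := by
    have h : ∀ᵐ z ∂(P.map (Z n)), z ∈ Set.Ico (-1 : ℝ) 0 := by
      rw [hZ.uniform n]
      exact ae_cond_mem measurableSet_Ico
    exact ae_of_ae_map (hZ.aemeasurable n) h
  refine MemLp.of_bound ((hZ.aemeasurable n).add_const _).aestronglyMeasurable (1 / 2) ?_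
  filter_upwards [hmem] with ω hω
  rw [Real.norm_eq_abs, abs_le]
  constructor <;> linarith [hω.1, hω.2]

lemma integral_noise_mul (hZ : IsQuantizationNoise P X Z) (m k : ℤ) :
    ∫ ω, (Z m ω + 1 / 2) * (Z k ω + 1 / 2) ∂P = if m = k then 1 / 12 else 0 := by
  split_ifs with h
  · subst h
    exact hZ.integral_sq m
  · have hi : IndepFun (fun ω => Z m ω + 1 / 2) (fun ω => Z k ω + 1 / 2) P :=
      (hZ.iid.indepFun h).comp (φ := fun x => x + 1 / 2) (ψ := fun x => x + 1 / 2)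
        (by fun_prop) (by fun_prop)
    have := hi.integral_fun_mul_eq_mul_integral (hZ.memLp m).aestronglyMeasurable
      (hZ.memLp k).aestronglyMeasurable
    rw [this, hZ.integral_eq_zero m, zero_mul]

lemma integral_signal_mul_noise (hX : IsZeroMeanStationary P X) (hZ : IsQuantizationNoise P X Z)
    (m k : ℤ) : ∫ ω, X m ω * (Z k ω + 1 / 2) ∂P = 0 := by
  have hi : IndepFun (X m) (fun ω => Z k ω + 1 / 2) P :=
    hZ.indep.comp (φ := fun x : ℤ → ℝ => x m) (ψ := fun x : ℤ → ℝ => x k + 1 / 2)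
      (by fun_prop) (by fun_prop)
  have := hi.integral_fun_mul_eq_mul_integral (hX.memLp m).aestronglyMeasurable
    (hZ.memLp k).aestronglyMeasurable
  rw [this, hX.mean_zero m, zero_mul]

/-- The centered version of the quantized process. -/
def centered (α : ℝ) (X Z : ℤ → Ω → ℝ) (n : ℤ) (ω : Ω) : ℝ := α * X n ω + (Z n ω + 1 / 2)

variable {α : ℝ}

lemma centered_memLp (hX : IsZeroMeanStationary P X) (hZ : IsQuantizationNoise P X Z) (n : ℤ) :
    MemLp (centered α X Z n) 2 P :=
  ((hX.memLp n).const_mul α).add (hZ.memLp n)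

/-- The cross terms vanish by independence, and the centered noise is white with variance `1/12`,
hence has constant density `1/12`. -/
lemma integral_centered_mul (hX : IsZeroMeanStationary P X) (hS : IsPSD P X S)
    (hZ : IsQuantizationNoise P X Z) (n : ℤ) (i j : ℕ) :
    ∫ ω, centered α X Z (n - i) ω * centered α X Z (n - j) ω ∂P
      = form (fun θ => α ^ 2 * evenPart S θ + 1 / 12) (.X ^ i) (.X ^ j) := by
  set m := n - (i : ℤ)
  set k := n - (j : ℤ)
  have ixx : Integrable (fun ω => X m ω * X k ω) P := (hX.memLp m).integrable_mul (hX.memLp k)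
  have ixz : ∀ m k, Integrable (fun ω => X m ω * (Z k ω + 1 / 2)) P := fun m k =>
    (hX.memLp m).integrable_mul (hZ.memLp k)
  have izz : Integrable (fun ω => (Z m ω + 1 / 2) * (Z k ω + 1 / 2)) P :=
    (hZ.memLp m).integrable_mul (hZ.memLp k)
  have e : ∀ ω, centered α X Z m ω * centered α X Z k ω = α ^ 2 * (X m ω * X k ω)
      + α * (X m ω * (Z k ω + 1 / 2)) + α * (X k ω * (Z m ω + 1 / 2))
      + (Z m ω + 1 / 2) * (Z k ω + 1 / 2) := by
    intro ω
    simp only [centered]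
    ring
  have hk : k = m - ((j : ℤ) - i) := by simp only [m, k]; ring
  have hcov : ∫ ω, X m ω * X k ω ∂P
      = 1 / Real.pi * ∫ θ in (0)..Real.pi, evenPart S θ * Real.cos (((i : ℤ) - j : ℤ) * θ) := by
    rw [hk, hS.autocov_eq_integral]
    congr 2
    ext θ
    rw [← Real.cos_neg]
    congr 2
    push_cast
    ring
  simp only [e]
  rw [integral_add (((ixx.const_mul _).fun_add ((ixz m k).const_mul _)).fun_add
      ((ixz k m).const_mul _)) izz,
    integral_add ((ixx.const_mul _).fun_add ((ixz m k).const_mul _)) ((ixz k m).const_mul _),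
    integral_add (ixx.const_mul _) ((ixz m k).const_mul _), integral_const_mul, integral_const_mul,
    integral_const_mul, integral_signal_mul_noise hX hZ, integral_signal_mul_noise hX hZ,
    integral_noise_mul hZ, hcov, form_monomials]
  have hcos := integral_cos_int_mul ((i : ℤ) - j)
  have hcont : Continuous fun θ : ℝ => Real.cos (((i : ℤ) - j : ℤ) * θ) := by fun_prop
  have e2 : ∀ θ : ℝ, (α ^ 2 * evenPart S θ + 1 / 12) * Real.cos (((i : ℤ) - j : ℤ) * θ)
      = α ^ 2 * (evenPart S θ * Real.cos (((i : ℤ) - j : ℤ) * θ))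
        + 1 / 12 * Real.cos (((i : ℤ) - j : ℤ) * θ) := fun θ => by ring
  simp only [e2]
  rw [intervalIntegral.integral_add
    ((hS.evenPart_integrable.mul_continuousOn hcont.continuousOn).const_mul _)
    ((hcont.intervalIntegrable _ _).const_mul _), intervalIntegral.integral_const_mul,
    intervalIntegral.integral_const_mul, mul_add, mul_left_comm (1 / Real.pi) (1 / 12), hcos]
  have hmk : (m = k) ↔ ((i : ℤ) - j = 0) := by simp only [m, k]; omega
  simp only [hmk]
  split_ifs <;> ring

/-- The prediction error in terms of the spectral densities of the signal and the noise. -/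
theorem predictionMSE_eq_form (hX : IsZeroMeanStationary P X) (hS : IsPSD P X S)
    (hZ : IsQuantizationNoise P X Z) {p : ℕ} (h : Fin p → ℝ) (n : ℤ) :
    predictionMSE P (quantized α X Z) h n
      = form (fun θ => α ^ 2 * evenPart S θ + 1 / 12) (errorPoly h) (errorPoly h) := by
  have hw : IntervalIntegrable (fun θ => α ^ 2 * evenPart S θ + 1 / 12) volume 0 Real.pi :=
    (hS.evenPart_integrable.const_mul _).add intervalIntegrable_const
  have herr : ∀ ω, quantized α X Z n ω - prediction (quantized α X Z) h n ω
      = ∑ i ∈ Finset.range (p + 1), (errorPoly h).coeff i * centered α X Z (n - i) ω := by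
    intro ω
    rw [Finset.sum_range_succ', errorPoly_coeff_zero, Finset.sum_range]
    simp only [errorPoly_coeff_succ, prediction, quantized, centered]
    push_cast
    simp only [neg_mul, Finset.sum_neg_distrib, add_assoc, sub_zero]
    ring
  have hint : ∀ i j : ℕ, Integrable (fun ω => (errorPoly h).coeff i * centered α X Z (n - i) ω *
      ((errorPoly h).coeff j * centered α X Z (n - j) ω)) P := fun i j =>
    ((centered_memLp hX hZ _).const_mul _).integrable_mul ((centered_memLp hX hZ _).const_mul _)
  unfold predictionMSE
  have hsq : ∀ ω, (quantized α X Z n ω - prediction (quantized α X Z) h n ω) ^ 2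
      = ∑ i ∈ Finset.range (p + 1), ∑ j ∈ Finset.range (p + 1),
        (errorPoly h).coeff i * centered α X Z (n - i) ω *
          ((errorPoly h).coeff j * centered α X Z (n - j) ω) := fun ω => by
    rw [herr, sq, Finset.sum_mul_sum]
  simp only [hsq]
  have hdeg : (errorPoly h).natDegree < p + 1 := Nat.lt_succ_of_le (errorPoly_natDegree_le h)
  rw [integral_finsetSum _ fun i _ => integrable_finsetSum _ fun j _ => hint i j, form_comm,
    form_eq_sum_right hw _ hdeg]
  refine Finset.sum_congr rfl fun i _ => ?_
  rw [integral_finsetSum _ fun j _ => hint i j, form_comm, form_eq_sum_right hw _ hdeg,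
    Finset.mul_sum]
  refine Finset.sum_congr rfl fun j _ => ?_
  rw [← integral_centered_mul hX hS hZ n i j, ← integral_const_mul, ← integral_const_mul]
  congr 1
  ext ω
  ring

end Covariance

end Spectral

/-! ### Optimal filters as predictors, and band-limited densities -/

section Filters

lemma form_const_mul (k : ℝ) (w : ℝ → ℝ) (p q : ℝ[X]) :
    form (fun θ => k * w θ) p q = k * form w p q := by
  unfold form
  simp only [mul_assoc]
  rw [intervalIntegral.integral_const_mul]
  ring

lemma form_congr_ae {w w' : ℝ → ℝ} (h : ∀ᵐ θ, θ ∈ Set.Ioc 0 Real.pi → w θ = w' θ) (p q : ℝ[X]) :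
    form w p q = form w' p q := by
  unfold form
  congr 1
  refine intervalIntegral.integral_congr_ae ?_
  rw [Set.uIoc_of_le Real.pi_pos.le]
  filter_upwards [h] with θ hθ hmem
  rw [hθ hmem]

lemma errorPoly_sub_single {p : ℕ} (h : Fin p → ℝ) (t : ℝ) (i : Fin p) :
    errorPoly (h - t • Pi.single i 1) = errorPoly h + t • X ^ ((i : ℕ) + 1) := by
  unfold errorPoly
  have : ∀ j : Fin p, (h - t • (Pi.single i 1 : Fin p → ℝ)) j • (X : ℝ[X]) ^ ((j : ℕ) + 1)
      = h j • X ^ ((j : ℕ) + 1) - (if j = i then t • X ^ ((i : ℕ) + 1) else 0) := by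
    intro j
    rcases eq_or_ne j i with rfl | hj
    · simp [sub_smul]
    · simp [hj]
  simp only [this, Finset.sum_sub_distrib]
  simp
  ring

/-- A filter that minimizes the prediction error satisfies the normal equations. -/
lemma isPredictor_errorPoly {w : ℝ → ℝ} (hw : IntervalIntegrable w volume 0 Real.pi) {p : ℕ}
    {h : Fin p → ℝ}
    (hopt : ∀ g : Fin p → ℝ, form w (errorPoly h) (errorPoly h) ≤ form w (errorPoly g) (errorPoly g)) :
    IsPredictor w p (errorPoly h) where
  natDegree_le := errorPoly_natDegree_le h
  coeff_zero := errorPoly_coeff_zero h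
  orth k hk1 hkp := by
    obtain ⟨i, rfl⟩ : ∃ i : Fin p, k = (i : ℕ) + 1 := ⟨⟨k - 1, by omega⟩, by simp; omega⟩
    -- Perturbing one tap gives a nonnegative quadratic in `t` with no constant term; its
    -- discriminant forces the linear coefficient to vanish.
    have hq : ∀ t : ℝ, 0 ≤ form w (X ^ ((i : ℕ) + 1)) (X ^ ((i : ℕ) + 1)) * (t * t)
        + 2 * form w (errorPoly h) (X ^ ((i : ℕ) + 1)) * t + 0 := by
      intro t
      have := hopt (h - t • Pi.single i 1)
      rw [errorPoly_sub_single, form_add_left hw, form_add_right hw, form_add_right hw,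
        form_smul_left, form_smul_left, form_smul_right, form_smul_right,
        form_comm w (X ^ _) (errorPoly h)] at this
      linarith
    have hd := discrim_le_zero hq
    rw [discrim] at hd
    have h2 : form w (errorPoly h) (X ^ ((i : ℕ) + 1)) ^ 2 ≤ 0 := by linarith
    exact pow_eq_zero_iff two_ne_zero |>.mp (le_antisymm h2 (sq_nonneg _))

/-- The band edge is excluded because the half-open band makes the even part `Lσ²/2` there; a single
point is harmless under the integral. -/
lemma evenPart_flatPSD {L σ : ℝ} (hL : 1 < L) {θ : ℝ} (h0 : 0 < θ) (hne : θ ≠ Real.pi / L) :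
    evenPart (flatPSD L σ) θ = if θ ≤ Real.pi / L then L * σ ^ 2 else 0 := by
  have hb : 0 < Real.pi / L := div_pos Real.pi_pos (by linarith)
  unfold evenPart flatPSD
  split_ifs with h
  · have hlt := lt_of_le_of_ne h hne
    have m1 : θ ∈ Set.Ico (-(Real.pi / L)) (Real.pi / L) := ⟨by linarith, hlt⟩
    have m2 : -θ ∈ Set.Ico (-(Real.pi / L)) (Real.pi / L) := ⟨by linarith, by linarith⟩
    rw [Set.indicator_of_mem m1, Set.indicator_of_mem m2]
    ring
  · rw [Set.indicator_of_notMem (fun hm => h hm.2.le),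
      Set.indicator_of_notMem (fun hm => h (by linarith [hm.1]))]
    ring

lemma evenPart_eq_zero {S : ℝ → ℝ} {L : ℝ}
    (hsupp : ∀ w ∈ Set.Icc (-Real.pi) Real.pi,
      w ∉ Set.Icc (-(Real.pi / L)) (Real.pi / L) → S w = 0) {θ : ℝ} (hθ : θ ∈ Set.Ioc 0 Real.pi)
    (h : Real.pi / L < θ) : evenPart S θ = 0 := by
  have hpi := Real.pi_pos
  rw [evenPart, hsupp θ ⟨by linarith [hθ.1], hθ.2⟩ (fun hm => hm.2.not_gt h),
    hsupp (-θ) ⟨by linarith [hθ.2], by linarith [hθ.1]⟩ (fun hm => by linarith [hm.1])]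
  simp

end Filters

end

end ModuloADC

/-! ### The main theorem -/

open ModuloADC

theorem proposition4
    (α σ L : ℝ) (hL : 1 < L)
    -- the design model, with flat band-limited spectrum, and its optimal `p`-tap filters `h p`
    {Ω' : Type*} [MeasurableSpace Ω'] (P' : Measure Ω') [IsProbabilityMeasure P']
    (X' Z' : ℤ → Ω' → ℝ)
    (hX' : ModuloADC.IsZeroMeanStationary P' X')
    (hS' : ModuloADC.IsPSD P' X' (ModuloADC.flatPSD L σ))
    (hZ' : ModuloADC.IsQuantizationNoise P' X' Z')
    (h : (p : ℕ) → Fin p → ℝ)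
    (hopt : ∀ p, ModuloADC.IsOptimalFilter P' (ModuloADC.quantized α X' Z') (h p))
    -- the actual process
    {Ω : Type*} [MeasurableSpace Ω] (P : Measure Ω) [IsProbabilityMeasure P]
    (X Z : ℤ → Ω → ℝ) (S : ℝ → ℝ)
    (hX : ModuloADC.IsZeroMeanStationary P X)
    (hvar : ∀ n, ∫ ω, X n ω ^ 2 ∂P ≤ σ ^ 2)
    (hS : ModuloADC.IsPSD P X S)
    (hsupp : ∀ w ∈ Set.Icc (-Real.pi) Real.pi,
      w ∉ Set.Icc (-(Real.pi / L)) (Real.pi / L) → S w = 0)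
    (hZ : ModuloADC.IsQuantizationNoise P X Z) :
    ∃ l : ℝ,
      (∀ n : ℤ, Tendsto
        (fun p : ℕ => 12 * ModuloADC.predictionMSE P (ModuloADC.quantized α X Z) (h p) n)
        atTop (𝓝 l)) ∧
      l ≤ (1 + 12 * α ^ 2 * L * σ ^ 2) ^ (1 / L) := by
  have hpi := Real.pi_pos
  have hL0 : 0 < L := by linarith
  set c := 12 * α ^ 2 * L * σ ^ 2 with hcdef
  set b := Real.pi / L with hbdef
  have hc : 0 ≤ c := by positivity
  have hb0 : 0 ≤ b := by positivity
  have hb : b ≤ Real.pi := div_le_self hpi.le hL.le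
  have hbpi : b / Real.pi = 1 / L := by rw [hbdef]; field_simp
  have hw := jumpWeight_intervalIntegrable hc b 0 Real.pi
  have h1 := one_le_jumpWeight (b := b) hc
  have hdesign : ∀ {p : ℕ} (g : Fin p → ℝ) (n : ℤ),
      12 * predictionMSE P' (quantized α X' Z') g n
        = form (jumpWeight c b) (errorPoly g) (errorPoly g) := by
    intro p g n
    rw [predictionMSE_eq_form hX' hS' hZ', ← form_const_mul]
    refine form_congr_ae ?_ _ _
    filter_upwards [compl_mem_ae_iff.mpr (measure_singleton (μ := volume) b)] with θ hθb hθ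
    rw [evenPart_flatPSD hL hθ.1 hθb, jumpWeight, hcdef]
    split_ifs <;> ring
  have hA : ∀ p, IsPredictor (jumpWeight c b) p (errorPoly (h p)) := fun p =>
    isPredictor_errorPoly hw fun g => by
      rw [← hdesign (h p) 0, ← hdesign g 0]
      exact mul_le_mul_of_nonneg_left (hopt p g 0) (by norm_num)
  obtain ⟨M, hM⟩ := exists_norm_sq_circleEval_le hc hb0 hb hA
  have hK : ∀ p θ, jumpWeight c b θ * ‖circleEval (errorPoly (h p)) θ‖ ^ 2 ≤ (1 + c) * M :=
    fun p θ => mul_le_mul (jumpWeight_le hc θ) (hM p θ) (by positivity) (by linarith)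
  have hSi := hS.evenPart_integrable
  -- On `(0, π]` this is the actual density over the design density. Dividing by `1 + c` throughout
  -- is legitimate since the numerator vanishes off the band, and it makes `g` affine in `S`, so its
  -- mean is explicit.
  set g : ℝ → ℝ := fun θ =>
    1 + (12 * α ^ 2 * evenPart S θ - (jumpWeight c b θ - 1)) / (1 + c) with hg
  have hgi0 : IntervalIntegrable
      (fun θ => 12 * α ^ 2 * evenPart S θ - (jumpWeight c b θ - 1)) volume 0 Real.pi :=
    (hSi.const_mul _).sub (hw.sub intervalIntegrable_const)
  have hgi : IntervalIntegrable g volume 0 Real.pi :=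
    intervalIntegrable_const.add (hgi0.div_const _)
  have hwg : ∀ θ ∈ Set.Ioc 0 Real.pi,
      jumpWeight c b θ * g θ = 12 * (α ^ 2 * evenPart S θ + 1 / 12) := by
    intro θ hθ
    have : 1 + c ≠ 0 := by positivity
    simp only [hg, jumpWeight]
    split_ifs with hle
    · field_simp
      ring
    · rw [evenPart_eq_zero hsupp hθ (not_le.mp hle)]
      simp
  have hmse : ∀ n p, 12 * predictionMSE P (quantized α X Z) (h p) n
      = 1 / Real.pi * ∫ θ in (0)..Real.pi,
        jumpWeight c b θ * ‖circleEval (errorPoly (h p)) θ‖ ^ 2 * g θ := by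
    intro n p
    rw [predictionMSE_eq_form hX hS hZ, ← form_const_mul,
      form_congr_ae (Eventually.of_forall fun θ hθ => (hwg θ hθ).symm), form_self]
    congr 1
    exact intervalIntegral.integral_congr fun θ _ => by ring
  have hvar0 : 1 / Real.pi * ∫ θ in (0)..Real.pi, evenPart S θ ≤ σ ^ 2 := by
    have e := hS.autocov_eq_integral 0 0
    simp only [Int.cast_zero, zero_mul, Real.cos_zero, mul_one, sub_zero, ← sq] at e
    rw [← e]
    exact hvar 0
  have hgint : 1 / Real.pi * ∫ θ in (0)..Real.pi, g θ ≤ 1 := by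
    have hj : ∫ θ in (0)..Real.pi, jumpWeight c b θ = Real.pi + c * b := by
      simpa using integral_jumpWeight_mul (c := c) hb0 hb
        (intervalIntegrable_const (c := (1 : ℝ)))
    have hgv : ∫ θ in (0)..Real.pi, g θ = Real.pi
        + (12 * α ^ 2 * (∫ θ in (0)..Real.pi, evenPart S θ) - c * b) / (1 + c) := by
      simp only [hg]
      rw [intervalIntegral.integral_add intervalIntegrable_const (hgi0.div_const _),
        intervalIntegral.integral_div, intervalIntegral.integral_sub (hSi.const_mul _)
        (hw.sub intervalIntegrable_const), intervalIntegral.integral_sub hw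
        intervalIntegrable_const, hj, intervalIntegral.integral_const_mul]
      simp
    -- The flat density carries exactly the power `σ²`, so the variance constraint makes the
    -- correction to the mean of `g` nonpositive.
    have hcb : c * b = 12 * α ^ 2 * (Real.pi * σ ^ 2) := by
      rw [hcdef, hbdef]
      field_simp
    have hS0 : ∫ θ in (0)..Real.pi, evenPart S θ ≤ Real.pi * σ ^ 2 := by
      rw [one_div_mul_eq_div, div_le_iff₀ hpi] at hvar0
      linarith
    rw [hgv, one_div_mul_eq_div, div_le_one hpi, hcb, ← mul_sub]
    have : 12 * α ^ 2 * ((∫ θ in (0)..Real.pi, evenPart S θ) - Real.pi * σ ^ 2) / (1 + c) ≤ 0 :=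
      div_nonpos_of_nonpos_of_nonneg
        (mul_nonpos_of_nonneg_of_nonpos (by positivity) (by linarith)) (by linarith)
    linarith
  have hlim := (tendsto_integral_predictor_mul hw h1 (measurable_jumpWeight c b) hA hK
    hgi).const_mul (1 / Real.pi)
  have he0 : 0 ≤ ⨅ p, form (jumpWeight c b) (errorPoly (h p)) (errorPoly (h p)) :=
    Real.iInf_nonneg fun p => form_self_nonneg hw h1 _
  have he := iInf_predictor_jumpWeight_le hc hb0 hb hA
  rw [hbpi] at he
  refine ⟨_, fun n => hlim.congr fun p => (hmse n p).symm, ?_⟩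
  rw [mul_left_comm]
  exact (mul_le_of_le_one_right he0 hgint).trans he
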